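/- **Theorem 6.13.** Let $\mathcal C$ be an abelian monoidal category with enough injectives whose tensor product is left exact in each variable. *Pairs.* Consider pairs $(\mathcal M,X)$ where $\mathcal M$ is an abelian left $\mathcal C$-module category with enough injectives whose action $\triangleright$ is left exact in each variable, and $X\in\mathcal M$ is - *coclosed*: the functor $-\triangleright X:\mathcal C\to\mathcal M$ has a left adjoint $[X,-]$; - *$\mathcal C$-injective*: $I\triangleright X$ is injective for every injective $I\in\mathcal C$; - a *$\mathcal C$-cogenerator*: every injective object of $\mathcal M$ is a direct summand of $I\triangleright X$ for some injective $I\in\mathcal C$. Two pairs $(\mathcal M,X)$, $(\mathcal N,Y)$ are identified if there is a strong $\mathcal C$-module functor $\mathcal M\to\mathcal N$ that is an equivalence of categories (it need not send $X$ to $Y$). *Comonads.* A left exact oplax $\mathcal C$-module comonad on $\mathcal C$ is a comonad $(K,\delta,\varepsilon)$ whose underlying functor is a left exact oplax $\mathcal C$-module functor, with structure morphisms $K_{V,W}:K(V\otimes W)\to V\otimes K(W)$, and for which $\delta$ and $\varepsilon$ are $\mathcal C$-module transformations. Its Eilenberg–Moore category $\mathrm{EM}(K)$ of $K$-comodules is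 equipped with the (extended, Linton) $\mathcal C$-module structure in which, for $V\in\mathcal C$ and $(A,a)\in\mathrm{EM}(K)$, $$V\blacktriangleright A=\mathrm{eq}\Bigl(K(V\otimes A)\rightrightarrows K(V\otimes K(A))\Bigr),$$ the two morphisms being $K(V\otimes a)$ and $K(K_{V,A})\circ\delta_{V\otimes A}$. The coaction on $V\blacktriangleright A$ is induced by $\delta_{V\otimes A}$, and the module constraints are induced by those of $\mathcal C$ via the canonical morphisms $V\blacktriangleright A\to K(V\otimes A)\xrightarrow{\ \varepsilon\ }V\otimes A$. *Morita equivalence.* Given two such comonads $K,K'$, an oplax $\mathcal C$-module $K$-$K'$-*bicoact functor* is a $K$-$K'$-bicomodule in the monoidal category of left exact oplax $\mathcal C$-module endofunctors of $\mathcal C$. That is, it is a left exact oplax $\mathcal C$-module functor $F:\mathcal C\to\mathcal C$ with $\mathcal C$-module transformations $F\Rightarrow K\circ F$ and $F\Rightarrow F\circ K'$ that are counital, coassociative, and commute with each other. The *cotensor product* of a $K$-$K'$-bicoact functor $F$ and a $K'$-$K$-bicoact functor $G$ is the $K$-$K$-bicoact functor $$F\mathbin{\square_{K'}}G=\mathrm{eq}\bigl(F\circ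 G\rightrightarrows F\circ K'\circ G\bigr),$$ the pointwise equalizer of the morphisms given by the right coaction of $F$ and the left coaction of $G$, with the structure induced from $F\circ G$. The comonads $K$ and $K'$ are *Morita equivalent* if there are a $K$-$K'$-bicoact functor $F$ and a $K'$-$K$-bicoact functor $G$ with $F\mathbin{\square_{K'}}G\cong K$ and $G\mathbin{\square_{K}}F\cong K'$ as bicoact functors, where the two coactions on $K$ and on $K'$ are the comultiplications. *Claim.* Both identifications are equivalence relations. For every pair $(\mathcal M,X)$ the comonad $[X,-\triangleright X]$ is left exact; it is an oplax $\mathcal C$-module comonad, its oplax structure being obtained from the strong module structure of $-\triangleright X$ by passing to mates under the adjunction $[X,-]\dashv -\triangleright X$. For every left exact oplax $\mathcal C$-module comonad $K$ on $\mathcal C$, the cofree comodule $K(\mathbb 1)$ is a coclosed $\mathcal C$-injective $\mathcal C$-cogenerator of $\mathrm{EM}(K)$, and $(\mathrm{EM}(K),K(\mathbb 1))$ is a pair as above. The assignments $$(\mathcal M,X)\longmapsto[X,-\triangleright X],\qquad K\longmapsto(\mathrm{EM}(K),K(\mathbb 1))$$ induce mutually inverse bijections $$\{(\mathcal M,X)\}/(\mathcal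 M\simeq\mathcal N)\;\cong\;\{\text{left exact oplax }\mathcal C\text{-module comonads on }\mathcal C\}/\simeq_{\mathrm{Morita}}.$$ Moreover, $K$ and $K'$ are Morita equivalent if and only if $\mathrm{EM}(K)$ and $\mathrm{EM}(K')$ are equivalent as $\mathcal C$-module categories. -/

import Mathlib

open CategoryTheory Category Limits MonoidalCategory MonoidalLeftAction

universe v u v₁ v₂ v₃ u₁ u₂ u₃

namespace ModCat

section ModuleFunctors

variable (C : Type u) [Category.{v} C] [MonoidalCategory C]
variable {D : Type u₁} [Category.{v₁} D] [MonoidalLeftAction C D]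
variable {E : Type u₂} [Category.{v₂} E] [MonoidalLeftAction C E]
variable {E' : Type u₃} [Category.{v₃} E'] [MonoidalLeftAction C E']

open Functor.OplaxLeftLinear Functor.LaxLeftLinear Functor.LeftLinear

/-- The identity functor as an oplax module functor. -/
instance oplaxId : (𝟭 D).OplaxLeftLinear C where
  δₗ c d := 𝟙 (c ⊙ₗ d)

/-- The composite of two oplax module functors. -/
instance oplaxComp (F : D ⥤ E) (G : E ⥤ E') [F.OplaxLeftLinear C] [G.OplaxLeftLinear C] :
    (F ⋙ G).OplaxLeftLinear C where
  δₗ c d := G.map (δₗ F c d) ≫ δₗ G c (F.obj d)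
  δₗ_naturality_left f d := by
    simp only [Functor.comp_map, Functor.comp_obj, assoc]
    rw [← δₗ_naturality_left, ← Functor.map_comp_assoc, ← Functor.map_comp_assoc,
      δₗ_naturality_left]
  δₗ_naturality_right c _ _ f := by
    simp only [Functor.comp_map, Functor.comp_obj, assoc]
    rw [← δₗ_naturality_right, ← Functor.map_comp_assoc, ← Functor.map_comp_assoc,
      δₗ_naturality_right]
  δₗ_associativity c c' d := by
    simp only [Functor.comp_map, Functor.comp_obj, assoc, actionHomRight_comp]
    rw [δₗ_associativity, ← Functor.map_comp_assoc, δₗ_associativity]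
    simp only [Functor.map_comp, assoc]
    rw [δₗ_naturality_right_assoc]
  δₗ_unitality_inv d := by
    simp only [Functor.comp_map, Functor.comp_obj]
    rw [← Functor.map_comp_assoc, ← δₗ_unitality_inv, ← δₗ_unitality_inv]

/-- A natural transformation between oplax module functors is a module transformation. -/
def IsModuleTransformation {F G : D ⥤ E} [F.OplaxLeftLinear C] [G.OplaxLeftLinear C]
    (τ : F ⟶ G) : Prop :=
  ∀ (c : C) (d : D), δₗ F c d ≫ c ⊴ₗ τ.app d = τ.app (c ⊙ₗ d) ≫ δₗ G c d


/-- For an object `X` of a module category, the functor `- ▷ X`. -/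
@[simps]
def actOn (X : D) : C ⥤ D where
  obj c := c ⊙ₗ X
  map f := f ⊵ₗ X

/-- The functor `- ▷ X` is a strong module functor. -/
instance actOnLeftLinear (X : D) : (actOn C X).LeftLinear C where
  μₗ c c' := (αₗ c c' X).inv
  δₗ c c' := (αₗ c c' X).hom
  μₗ_naturality_left f c := by
    change f ⊵ₗ (c ⊙ₗ X) ≫ (αₗ _ c X).inv = (αₗ _ c X).inv ≫ (f ▷ c) ⊵ₗ X
    simp
  μₗ_naturality_right c _ _ f := by
    change c ⊴ₗ (f ⊵ₗ X) ≫ (αₗ c _ X).inv = (αₗ c _ X).inv ≫ (c ◁ f) ⊵ₗ X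
    simp
  μₗ_associativity c c' c'' := by
    change (αₗ (c ⊗ c') c'' X).inv ≫ (α_ c c' c'').hom ⊵ₗ X =
      (αₗ c c' (c'' ⊙ₗ X)).hom ≫ c ⊴ₗ (αₗ c' c'' X).inv ≫ (αₗ c (c' ⊗ c'') X).inv
    have h := associator_actionHom (D := D) c c' c'' X
    rw [Iso.inv_comp_eq, ← reassoc_of% h]
    simp
  μₗ_unitality c := by
    change (λₗ (c ⊙ₗ X)).hom = (αₗ (𝟙_ C) c X).inv ≫ (λ_ c).hom ⊵ₗ X
    simp
  δₗ_naturality_left f c := by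
    change (f ▷ c) ⊵ₗ X ≫ (αₗ _ c X).hom = (αₗ _ c X).hom ≫ f ⊵ₗ (c ⊙ₗ X)
    simp
  δₗ_naturality_right c _ _ f := by
    change (c ◁ f) ⊵ₗ X ≫ (αₗ c _ X).hom = (αₗ c _ X).hom ≫ c ⊴ₗ (f ⊵ₗ X)
    simp
  δₗ_associativity c c' c'' := (associator_actionHom (D := D) c c' c'' X).symm
  δₗ_unitality_inv c := by
    change (λₗ (c ⊙ₗ X)).inv = (λ_ c).inv ⊵ₗ X ≫ (αₗ (𝟙_ C) c X).hom
    have h := leftUnitor_actionHom (D := D) c X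
    rw [← cancel_mono (λₗ (c ⊙ₗ X)).hom, assoc, ← h]
    simp [-leftUnitor_actionHom]
  μₗ_comp_δₗ c c' := Iso.inv_hom_id _
  δₗ_comp_μₗ c c' := Iso.hom_inv_id _

section adj
variable {C}
variable {L : E ⥤ D} {R : D ⥤ E} (adj : L ⊣ R) [R.LeftLinear C]

/-- The mate of the structure morphisms `c ▷ R d ≅ R (c ▷ d)`, namely
`L (c ▷ e) ⟶ L (c ▷ R (L e)) ≅ L (R (c ▷ L e)) ⟶ c ▷ L e`. -/
def mate (c : C) (e : E) : L.obj (c ⊙ₗ e) ⟶ c ⊙ₗ L.obj e :=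
  L.map (c ⊴ₗ adj.unit.app e ≫ μₗ R c (L.obj e)) ≫ adj.counit.app (c ⊙ₗ L.obj e)

lemma unit_mate (c : C) (e : E) :
    adj.unit.app (c ⊙ₗ e) ≫ R.map (mate adj c e) = c ⊴ₗ adj.unit.app e ≫ μₗ R c (L.obj e) := by
  simp [mate]

lemma mate_naturality_right (c : C) {e e' : E} (f : e ⟶ e') :
    L.map (c ⊴ₗ f) ≫ mate adj c e' = mate adj c e ≫ c ⊴ₗ L.map f := by
  apply (adj.homEquiv _ _).injective
  have h := adj.unit.naturality (c ⊴ₗ f)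
  have h' := adj.unit.naturality f
  dsimp at h h'
  simp only [Adjunction.homEquiv_unit, Functor.map_comp]
  rw [reassoc_of% (unit_mate adj), ← reassoc_of% h, unit_mate, ← μₗ_naturality_right,
    ← actionHomRight_comp_assoc, ← actionHomRight_comp_assoc, h']

/-- The left adjoint of a strong module functor is an oplax module functor. -/
@[reducible] def oplaxOfAdj : L.OplaxLeftLinear C where
  δₗ c e := mate adj c e
  δₗ_naturality_left f d := by
    apply (adj.homEquiv _ _).injective
    have h := adj.unit.naturality (f ⊵ₗ d)
    dsimp at h
    simp only [Adjunction.homEquiv_unit, Functor.map_comp]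
    rw [reassoc_of% (unit_mate adj), ← reassoc_of% h, unit_mate, ← μₗ_naturality_left,
      ← action_exchange_assoc]
    rfl
  δₗ_naturality_right c _ _ f := mate_naturality_right adj c f
  δₗ_associativity c c' d := by
    apply (adj.homEquiv _ _).injective
    have h := adj.unit.naturality (αₗ c c' d).hom
    dsimp at h
    simp only [Adjunction.homEquiv_unit, Functor.map_comp]
    rw [reassoc_of% (unit_mate adj), ← reassoc_of% h, reassoc_of% (unit_mate adj),
      ← μₗ_naturality_right, ← actionHomRight_comp_assoc, unit_mate, μₗ_associativity]
    simp
  δₗ_unitality_inv d := by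
    apply (adj.homEquiv _ _).injective
    have h := adj.unit.naturality (λₗ[C] d).inv
    dsimp at h
    simp only [Adjunction.homEquiv_unit, Functor.map_comp]
    rw [← reassoc_of% h, unit_mate, actionUnitIso_inv_naturality_assoc]
    exact congrArg _ (μₗ_unitality_inv R (L.obj d)).symm

/-- An oplax module comonad: a comonad whose underlying functor is an oplax module functor
and whose counit and comultiplication are module transformations. -/
structure OplaxModuleComonad (C : Type u) [Category.{v} C] [MonoidalCategory C]
    (D : Type u₁) [Category.{v₁} D] [MonoidalLeftAction C D] extends Comonad D where
  oplax : toFunctor.OplaxLeftLinear C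
  counit_mod : IsModuleTransformation C ε
  comul_mod : IsModuleTransformation C δ

attribute [instance] OplaxModuleComonad.oplax

/-- Given a strong module functor `R` and a left adjoint `L` of `R`, the oplax module comonad
`d ↦ L (R d)`. Its counit and comultiplication are those of the adjunction, and its structure
morphisms `L (R (c ▷ d)) ≅ L (c ▷ R d) ⟶ c ▷ L (R d)` are composed of the inverse structure
isomorphism of `R` and the mate of the structure isomorphism of `R`. -/
def OplaxModuleComonad.ofAdjunction : OplaxModuleComonad C D where
  toComonad := adj.toComonad
  oplax := letI := oplaxOfAdj (C := C) adj; oplaxComp C R L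
  counit_mod c d := by
    change (L.map (δₗ R c d) ≫ mate adj c (R.obj d)) ≫ c ⊴ₗ adj.counit.app d =
      adj.counit.app (c ⊙ₗ d) ≫ 𝟙 _
    apply (adj.homEquiv _ _).injective
    have h := adj.unit.naturality (δₗ R c d)
    dsimp at h
    simp only [Adjunction.homEquiv_unit, Functor.map_comp, assoc]
    rw [← reassoc_of% h, reassoc_of% (unit_mate adj), ← μₗ_naturality_right,
      ← actionHomRight_comp_assoc]
    simp
  comul_mod c d := by
    change (L.map (δₗ R c d) ≫ mate adj c (R.obj d)) ≫ c ⊴ₗ L.map (adj.unit.app (R.obj d)) =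
      L.map (adj.unit.app (R.obj (c ⊙ₗ d))) ≫
        L.map (R.map (L.map (δₗ R c d) ≫ mate adj c (R.obj d))) ≫ 
        L.map (δₗ R c (L.obj (R.obj d))) ≫ mate adj c (R.obj (L.obj (R.obj d)))
    have h := adj.unit.naturality (δₗ R c d)
    have h' := mate_naturality_right adj c (adj.unit.app (R.obj d))
    dsimp at h h'
    rw [assoc, ← h', ← L.map_comp_assoc, ← L.map_comp_assoc, ← L.map_comp_assoc]
    congr 2
    rw [R.map_comp, ← reassoc_of% h, unit_mate]
    simp

end adj

end ModuleFunctors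

section EilenbergMoore

open Functor.OplaxLeftLinear

variable {C : Type u} [Category.{v} C] [MonoidalCategory C]
variable {D : Type u₁} [Category.{v₁} D] [MonoidalLeftAction C D]

/-- The action `c ▷ d` is left exact in each of the two variables. -/
class SeparatelyLeftExact (C : Type u) [Category.{v} C] [MonoidalCategory C]
    (D : Type u₁) [Category.{v₁} D] [MonoidalLeftAction C D] : Prop where
  left (c : C) : PreservesFiniteLimits (actionLeft D c)
  right (d : D) : PreservesFiniteLimits (actOn C d)

attribute [instance] SeparatelyLeftExact.left SeparatelyLeftExact.right

/-- A left exact oplax module comonad. -/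
structure LeftExactComonad (C : Type u) [Category.{v} C] [MonoidalCategory C]
    (D : Type u₁) [Category.{v₁} D] [MonoidalLeftAction C D] extends OplaxModuleComonad C D where
  lex : PreservesFiniteLimits toFunctor

attribute [instance] LeftExactComonad.lex

namespace LeftExactComonad

variable (K : LeftExactComonad C D)

/-- The Eilenberg--Moore category. -/
abbrev EM : Type (max u₁ v₁) := K.toComonad.Coalgebra

/-- The structure morphism `K (c ▷ d) ⟶ c ▷ K d`. -/
abbrev str (c : C) (d : D) : K.obj (c ⊙ₗ d) ⟶ c ⊙ₗ K.obj d := δₗ K.toFunctor c d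

lemma str_counit (c : C) (d : D) : K.str c d ≫ c ⊴ₗ K.ε.app d = K.ε.app (c ⊙ₗ d) := by
  simpa using (K.counit_mod c d).trans (comp_id _)

lemma str_comul (c : C) (d : D) : K.str c d ≫ c ⊴ₗ K.δ.app d =
    K.δ.app (c ⊙ₗ d) ≫ K.map (K.str c d) ≫ K.str c (K.obj d) := 
  K.comul_mod c d


section Multilinear

variable {K}

/-- For `K`-comodules `A` and `B`, a morphism `B ⟶ c ▷ A` of underlying objects is multilinear
if the two resulting morphisms `B ⟶ c ▷ K A` agree. -/
def IsMultilinear (K : LeftExactComonad C D) (c : C) {B A : K.EM} (f : B.A ⟶ c ⊙ₗ A.A) : Prop :=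
  B.a ≫ K.map f ≫ K.str c A.A = f ≫ c ⊴ₗ A.a

lemma IsMultilinear.precomp {c : C} {B B' A : K.EM} {f : B.A ⟶ c ⊙ₗ A.A}
    (hf : K.IsMultilinear c f) (g : B' ⟶ B) : K.IsMultilinear c (g.f ≫ f) := by
  dsimp only [IsMultilinear] at hf ⊢
  rw [Functor.map_comp, assoc, g.h_assoc, hf, assoc]

lemma IsMultilinear.postcomp {c : C} {B A A' : K.EM} {f : B.A ⟶ c ⊙ₗ A.A}
    (hf : K.IsMultilinear c f) (g : A ⟶ A') : K.IsMultilinear c (f ≫ c ⊴ₗ g.f) := by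
  have := δₗ_naturality_right K.toFunctor c g.f
  dsimp only [IsMultilinear, str] at hf ⊢
  rw [Functor.map_comp, assoc, this, reassoc_of% hf, assoc, ← actionHomRight_comp,
    ← actionHomRight_comp, g.h]

lemma IsMultilinear.act {c c' : C} {B A : K.EM} {f : B.A ⟶ c ⊙ₗ A.A}
    (hf : K.IsMultilinear c f) (g : c ⟶ c') : K.IsMultilinear c' (f ≫ g ⊵ₗ A.A) := by
  have := δₗ_naturality_left K.toFunctor g A.A
  dsimp only [IsMultilinear, str] at hf ⊢
  rw [Functor.map_comp, assoc, this, reassoc_of% hf, assoc, action_exchange]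

lemma IsMultilinear.tensor {c c' : C} {B A A' : K.EM} {f : B.A ⟶ c ⊙ₗ A.A}
    (hf : K.IsMultilinear c f) {g : A.A ⟶ c' ⊙ₗ A'.A} (hg : K.IsMultilinear c' g) :
    K.IsMultilinear (c ⊗ c') (f ≫ c ⊴ₗ g ≫ (αₗ c c' A'.A).inv) := by
  have h1 := δₗ_associativity_inv K.toFunctor c c' A'.A
  have h2 := δₗ_naturality_right K.toFunctor c g
  dsimp only [IsMultilinear, str] at hf hg ⊢
  simp only [Functor.map_comp, assoc]
  rw [← h1, reassoc_of% h2, reassoc_of% hf, ← actionHomRight_comp_assoc,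
    ← actionHomRight_comp_assoc, assoc, hg]
  simp

lemma IsMultilinear.unit (A : K.EM) : K.IsMultilinear (𝟙_ C) (λₗ A.A).inv := by
  have h1 := δₗ_unitality_inv (C := C) K.toFunctor A.A
  dsimp only [IsMultilinear, str] at h1 ⊢
  rw [← h1, actionUnitIso_inv_naturality]

end Multilinear

variable [HasEqualizers D] (c : C) (A : K.EM)

/-- The object underlying the Linton equalizer. -/
noncomputable def lintonObj : D :=
  equalizer (K.map (c ⊴ₗ A.a)) (K.δ.app (c ⊙ₗ A.A) ≫ K.map (K.str c A.A))

/-- The inclusion of the Linton equalizer. -/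
noncomputable def lintonι : K.lintonObj c A ⟶ K.obj (c ⊙ₗ A.A) := equalizer.ι _ _

instance : Mono (K.lintonι c A) := inferInstanceAs (Mono (equalizer.ι _ _))

instance mono_map {X Y : D} (f : X ⟶ Y) [Mono f] : Mono (K.map f) :=
  inferInstanceAs (Mono (K.toFunctor.map f))

lemma lintonι_condition : K.lintonι c A ≫ K.map (c ⊴ₗ A.a) =
    K.lintonι c A ≫ K.δ.app (c ⊙ₗ A.A) ≫ K.map (K.str c A.A) :=
  equalizer.condition _ _

lemma lintonFactor (F : D ⥤ D) [PreservesFiniteLimits F] {X : D}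
    (f : X ⟶ F.obj (K.obj (c ⊙ₗ A.A)))
    (h : f ≫ F.map (K.map (c ⊴ₗ A.a)) =
      f ≫ F.map (K.δ.app (c ⊙ₗ A.A) ≫ K.map (K.str c A.A))) :
    ∃ g : X ⟶ F.obj (K.lintonObj c A), g ≫ F.map (K.lintonι c A) = f := by
  have hl := isLimitForkMapOfIsLimit F (K.lintonι_condition c A) (equalizerIsEqualizer _ _)
  exact ⟨Fork.IsLimit.lift hl f h, Fork.IsLimit.lift_ι hl⟩

lemma exists_lintonCoact : ∃ g : K.lintonObj c A ⟶ K.obj (K.lintonObj c A),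
    g ≫ K.map (K.lintonι c A) = K.lintonι c A ≫ K.δ.app (c ⊙ₗ A.A) := by
  refine K.lintonFactor c A K.toFunctor _ ?_
  have h1 := Comonad.delta_naturality _ K.toComonad (c ⊴ₗ A.a)
  have h2 := Comonad.delta_naturality _ K.toComonad (K.str c A.A)
  have h3 := K.toComonad.coassoc (c ⊙ₗ A.A)
  rw [Functor.map_comp, assoc, assoc, ← h1, reassoc_of% h3, ← h2,
    reassoc_of% K.lintonι_condition c A]

/-- The Linton equalizer `c ▶ A` of `K (c ▷ a)` and `K (str) ∘ δ` from `K (c ▷ A)` to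
`K (c ▷ K A)`, as a `K`-comodule. -/
noncomputable def linton : K.EM where
  A := K.lintonObj c A
  a := (K.exists_lintonCoact c A).choose
  counit := by
    have h := (K.exists_lintonCoact c A).choose_spec
    rw [← cancel_mono (K.lintonι c A), assoc, ← Comonad.counit_naturality,
      reassoc_of% h, K.toComonad.left_counit]
    simp
  coassoc := by
    have h := (K.exists_lintonCoact c A).choose_spec
    rw [← cancel_mono (K.map (K.map (K.lintonι c A))), assoc, assoc,
      ← Comonad.delta_naturality, reassoc_of% h, ← Functor.map_comp,
      h, Functor.map_comp, reassoc_of% h, K.toComonad.coassoc]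

/-- The inclusion `c ▶ A ⟶ K (c ▷ A)`. -/
noncomputable def incl : (K.linton c A).A ⟶ K.obj (c ⊙ₗ A.A) := K.lintonι c A

instance mono_incl : Mono (K.incl c A) := inferInstanceAs (Mono (K.lintonι c A))

lemma coact_incl : (K.linton c A).a ≫ K.map (K.incl c A) = K.incl c A ≫ K.δ.app (c ⊙ₗ A.A) :=
  (K.exists_lintonCoact c A).choose_spec

lemma incl_condition : K.incl c A ≫ K.map (c ⊴ₗ A.a) =
    K.incl c A ≫ K.δ.app (c ⊙ₗ A.A) ≫ K.map (K.str c A.A) :=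
  K.lintonι_condition c A

/-- The universal multilinear morphism `c ▶ A ⟶ c ▷ A`. -/
noncomputable def univ : (K.linton c A).A ⟶ c ⊙ₗ A.A := K.incl c A ≫ K.ε.app (c ⊙ₗ A.A)

variable {K c A}

lemma coact_univ : (K.linton c A).a ≫ K.map (K.univ c A) = K.incl c A := by
  dsimp only [univ]
  rw [Functor.map_comp, reassoc_of% K.coact_incl c A, K.toComonad.right_counit, comp_id]

lemma isMultilinear_univ : K.IsMultilinear c (K.univ c A) := by
  dsimp only [IsMultilinear]
  rw [reassoc_of% (coact_univ (K := K) (c := c) (A := A)), univ, assoc,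
    ← Comonad.counit_naturality, reassoc_of% K.incl_condition c A, Comonad.counit_naturality,
    K.toComonad.left_counit_assoc]

lemma exists_lift {B : K.EM} (f : B.A ⟶ c ⊙ₗ A.A) (hf : K.IsMultilinear c f) :
    ∃ g : B ⟶ K.linton c A, g.f ≫ K.univ c A = f := by
  obtain ⟨g, hg⟩ : ∃ g : B.A ⟶ (K.linton c A).A, g ≫ K.incl c A = B.a ≫ K.map f :=
    K.lintonFactor c A (𝟭 D) (B.a ≫ K.map f) (by
      dsimp
      rw [assoc, assoc, ← Functor.map_comp, ← hf, Comonad.delta_naturality_assoc,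
        B.coassoc_assoc]
      simp)
  refine ⟨⟨g, ?_⟩, ?_⟩
  · rw [← cancel_mono (K.map (K.incl c A)), assoc, assoc, ← Functor.map_comp, hg,
      K.coact_incl, reassoc_of% hg, Comonad.delta_naturality, B.coassoc_assoc]
    simp
  · dsimp only [univ]
    rw [reassoc_of% hg, Comonad.counit_naturality, B.counit_assoc]

/-- The morphism of comodules into `c ▶ A` induced by a multilinear morphism. -/
noncomputable def lift {B : K.EM} (f : B.A ⟶ c ⊙ₗ A.A) (hf : K.IsMultilinear c f) :
    B ⟶ K.linton c A := (exists_lift f hf).choose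

lemma lift_univ {B : K.EM} (f : B.A ⟶ c ⊙ₗ A.A) (hf : K.IsMultilinear c f) :
    (lift f hf).f ≫ K.univ c A = f := (exists_lift f hf).choose_spec

lemma lift_univ_assoc {B : K.EM} (f : B.A ⟶ c ⊙ₗ A.A) (hf : K.IsMultilinear c f) {Z : D}
    (h : c ⊙ₗ A.A ⟶ Z) : (lift f hf).f ≫ K.univ c A ≫ h = f ≫ h := by
  rw [← assoc, lift_univ]

lemma univ_ext {B : K.EM} {g g' : B ⟶ K.linton c A}
    (h : g.f ≫ K.univ c A = g'.f ≫ K.univ c A) : g = g' := by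
  have key (g : B ⟶ K.linton c A) : g.f ≫ K.incl c A = B.a ≫ K.map (g.f ≫ K.univ c A) := by
    rw [← coact_univ, ← g.h_assoc, Functor.map_comp]
  ext
  rw [← cancel_mono (K.incl c A), key, h, key]

section

variable [SeparatelyLeftExact C D]

instance mono_action (c : C) {X Y : D} (f : X ⟶ Y) [Mono f] : Mono (c ⊴ₗ f) :=
  inferInstanceAs (Mono ((actionLeft D c).map f))

lemma nested_ext {c c' : C} {B : K.EM} {h h' : B.A ⟶ c ⊙ₗ (K.linton c' A).A}
    (hh : K.IsMultilinear c h) (hh' : K.IsMultilinear c h')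
    (e : h ≫ c ⊴ₗ K.univ c' A = h' ≫ c ⊴ₗ K.univ c' A) : h = h' := by
  have key (h : B.A ⟶ c ⊙ₗ (K.linton c' A).A) (hh : K.IsMultilinear c h) :
      h ≫ c ⊴ₗ K.incl c' A =
        B.a ≫ K.map (h ≫ c ⊴ₗ K.univ c' A) ≫ K.str c (c' ⊙ₗ A.A) := by
    have h2 := δₗ_naturality_right K.toFunctor c (K.univ c' A)
    dsimp only [IsMultilinear, str] at hh ⊢
    rw [← coact_univ, actionHomRight_comp, ← reassoc_of% hh, Functor.map_comp, assoc, h2]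
  rw [← cancel_mono (c ⊴ₗ K.incl c' A), key h hh, e, key h' hh']

lemma nested_exists {c c' : C} {B : K.EM} (f : B.A ⟶ (c ⊗ c') ⊙ₗ A.A)
    (hf : K.IsMultilinear (c ⊗ c') f) : ∃ h : B.A ⟶ c ⊙ₗ (K.linton c' A).A,
    K.IsMultilinear c h ∧ h ≫ c ⊴ₗ K.univ c' A = f ≫ (αₗ c c' A.A).hom := by
  dsimp only [IsMultilinear] at hf
  set f' := f ≫ (αₗ c c' A.A).hom with hf'
  have hf'' : B.a ≫ K.map f' ≫ K.str c (c' ⊙ₗ A.A) ≫ c ⊴ₗ K.str c' A.A =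
      f' ≫ c ⊴ₗ c' ⊴ₗ A.a := by
    have := δₗ_associativity K.toFunctor c c' A.A
    rw [hf', Functor.map_comp, assoc, ← this, reassoc_of% hf, tensor_actionHomRight]
    simp
  have n1 := δₗ_naturality_right K.toFunctor c (c' ⊴ₗ A.a)
  have n2 := δₗ_naturality_right K.toFunctor c (K.str c' A.A)
  have n3 := δₗ_naturality_right K.toFunctor c (K.incl c' A)
  have fork : (B.a ≫ K.map f' ≫ K.str c (c' ⊙ₗ A.A)) ≫ c ⊴ₗ K.map (c' ⊴ₗ A.a) =
      (B.a ≫ K.map f' ≫ K.str c (c' ⊙ₗ A.A)) ≫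
        c ⊴ₗ (K.δ.app (c' ⊙ₗ A.A) ≫ K.map (K.str c' A.A)) := by
    simp only [assoc, actionHomRight_comp]
    rw [← n1, ← Functor.map_comp_assoc, ← hf'', reassoc_of% (K.str_comul c (c' ⊙ₗ A.A)), ← n2,
      Comonad.delta_naturality_assoc, B.coassoc_assoc]
    simp
  obtain ⟨h, hh⟩ : ∃ h : B.A ⟶ c ⊙ₗ (K.linton c' A).A, h ≫ c ⊴ₗ K.incl c' A =
      B.a ≫ K.map f' ≫ K.str c (c' ⊙ₗ A.A) :=
    K.lintonFactor c' A (actionLeft D c) (B.a ≫ K.map f' ≫ K.str c (c' ⊙ₗ A.A)) fork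
  refine ⟨h, ?_, ?_⟩
  · dsimp only [IsMultilinear]
    rw [← cancel_mono (c ⊴ₗ K.map (K.incl c' A))]
    simp only [assoc]
    rw [← n3, ← Functor.map_comp_assoc, hh, ← actionHomRight_comp, K.coact_incl,
      actionHomRight_comp, reassoc_of% hh, K.str_comul, Comonad.delta_naturality_assoc,
      B.coassoc_assoc]
    simp
  · dsimp only [univ]
    rw [actionHomRight_comp, reassoc_of% hh, K.str_counit, Comonad.counit_naturality,
      B.counit_assoc]

variable (K) in
/-- The associativity isomorphism `(c ⊗ c') ▶ A ≅ c ▶ (c' ▶ A)`. -/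
noncomputable def lintonAssoc (c c' : C) (A : K.EM) :
    K.linton (c ⊗ c') A ≅ K.linton c (K.linton c' A) where
  hom := lift (nested_exists _ isMultilinear_univ).choose
    (nested_exists _ isMultilinear_univ).choose_spec.1
  inv := lift (K.univ c (K.linton c' A) ≫ c ⊴ₗ K.univ c' A ≫ (αₗ c c' A.A).inv)
    (isMultilinear_univ.tensor isMultilinear_univ)
  hom_inv_id := by
    apply univ_ext
    rw [Comonad.Coalgebra.comp_f, assoc, lift_univ, lift_univ_assoc,
      reassoc_of% (nested_exists _ isMultilinear_univ).choose_spec.2]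
    simp
  inv_hom_id := by
    apply univ_ext
    apply nested_ext
    · exact isMultilinear_univ.precomp _
    · exact isMultilinear_univ.precomp _
    · simp only [Comonad.Coalgebra.comp_f, assoc]
      rw [lift_univ_assoc, (nested_exists _ isMultilinear_univ).choose_spec.2, lift_univ_assoc]
      simp

lemma lintonAssoc_inv_univ (c c' : C) (A : K.EM) :
    (K.lintonAssoc c c' A).inv.f ≫ K.univ (c ⊗ c') A =
      K.univ c (K.linton c' A) ≫ c ⊴ₗ K.univ c' A ≫ (αₗ c c' A.A).inv :=
  lift_univ _ (isMultilinear_univ.tensor isMultilinear_univ)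

lemma lintonAssoc_inv_univ_assoc (c c' : C) (A : K.EM) {Z : D} (h : (c ⊗ c') ⊙ₗ A.A ⟶ Z) :
    (K.lintonAssoc c c' A).inv.f ≫ K.univ (c ⊗ c') A ≫ h =
      K.univ c (K.linton c' A) ≫ c ⊴ₗ K.univ c' A ≫ (αₗ c c' A.A).inv ≫ h := by
  rw [← assoc, lintonAssoc_inv_univ]
  simp only [assoc]

end

variable (K) in
/-- The unit isomorphism `𝟙 ▶ A ≅ A`. -/
noncomputable def lintonUnit (A : K.EM) : K.linton (𝟙_ C) A ≅ A where
  hom :=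
    { f := K.univ (𝟙_ C) A ≫ (λₗ A.A).hom
      h := by
        have h := isMultilinear_univ (K := K) (c := 𝟙_ C) (A := A)
        have h1 := δₗ_unitality_hom (C := C) K.toFunctor A.A
        dsimp only [IsMultilinear, str] at h h1
        rw [Functor.map_comp, ← h1, reassoc_of% h, ← actionUnitIso_hom_naturality, assoc] }
  inv := lift (λₗ A.A).inv (IsMultilinear.unit A)
  hom_inv_id := by
    apply univ_ext
    rw [Comonad.Coalgebra.comp_f, assoc, lift_univ]
    simp
  inv_hom_id := by
    ext
    rw [Comonad.Coalgebra.comp_f, lift_univ_assoc]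
    simp

lemma lintonUnit_inv_univ (A : K.EM) :
    (K.lintonUnit A).inv.f ≫ K.univ (𝟙_ C) A = (λₗ A.A).inv :=
  lift_univ _ (IsMultilinear.unit A)

lemma lintonUnit_inv_univ_assoc (A : K.EM) {Z : D} (h : 𝟙_ C ⊙ₗ A.A ⟶ Z) :
    (K.lintonUnit A).inv.f ≫ K.univ (𝟙_ C) A ≫ h = (λₗ A.A).inv ≫ h := by
  rw [← assoc, lintonUnit_inv_univ]


variable (K) in
/-- The action of a morphism `f` of `C` on `- ▶ A`. -/
noncomputable def lintonLeft {c c' : C} (f : c ⟶ c') (A : K.EM) : K.linton c A ⟶ K.linton c' A :=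
  lift (K.univ c A ≫ f ⊵ₗ A.A) (isMultilinear_univ.act f)

variable (K) in
/-- The action of `c ▶ -` on a morphism of comodules. -/
noncomputable def lintonRight (c : C) {A A' : K.EM} (g : A ⟶ A') : K.linton c A ⟶ K.linton c A' :=
  lift (K.univ c A ≫ c ⊴ₗ g.f) (isMultilinear_univ.postcomp g)

lemma lintonLeft_univ {c c' : C} (f : c ⟶ c') (A : K.EM) :
    (K.lintonLeft f A).f ≫ K.univ c' A = K.univ c A ≫ f ⊵ₗ A.A :=
  lift_univ _ (isMultilinear_univ.act f)

lemma lintonLeft_univ_assoc {c c' : C} (f : c ⟶ c') (A : K.EM) {Z : D} (h : c' ⊙ₗ A.A ⟶ Z) :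
    (K.lintonLeft f A).f ≫ K.univ c' A ≫ h = K.univ c A ≫ f ⊵ₗ A.A ≫ h := by
  rw [← assoc, lintonLeft_univ, assoc]

lemma lintonRight_univ (c : C) {A A' : K.EM} (g : A ⟶ A') :
    (K.lintonRight c g).f ≫ K.univ c A' = K.univ c A ≫ c ⊴ₗ g.f :=
  lift_univ _ (isMultilinear_univ.postcomp g)

lemma lintonRight_univ_assoc (c : C) {A A' : K.EM} (g : A ⟶ A') {Z : D}
    (h : c ⊙ₗ A'.A ⟶ Z) :
    (K.lintonRight c g).f ≫ K.univ c A' ≫ h = K.univ c A ≫ c ⊴ₗ g.f ≫ h := by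
  rw [← assoc, lintonRight_univ, assoc]

lemma lintonRight_inv_hom (c : C) {A A' : K.EM} (e : A ≅ A') :
    K.lintonRight c e.inv ≫ K.lintonRight c e.hom = 𝟙 _ := by
  apply univ_ext
  rw [Comonad.Coalgebra.comp_f, assoc, lintonRight_univ, lintonRight_univ_assoc,
    ← actionHomRight_comp, ← Comonad.Coalgebra.comp_f, e.inv_hom_id]
  simp

/-- The extended module structure on the Eilenberg--Moore category of a left exact oplax module
comonad: the object `c ▷ A` is the Linton equalizer, and all structure morphisms are induced by
those of `D` via the universal multilinear morphisms `c ▶ A ⟶ c ▷ A`. -/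
noncomputable instance emAction [SeparatelyLeftExact C D] : MonoidalLeftAction C K.EM where
  actionObj c A := K.linton c A
  actionHomLeft f A := K.lintonLeft f A
  actionHomRight c _ _ g := K.lintonRight c g
  actionAssocIso c c' A := K.lintonAssoc c c' A
  actionUnitIso A := K.lintonUnit A
  actionHomRight_id c A := by
    apply univ_ext
    simp [lintonRight_univ]
  id_actionHomLeft c A := by
    apply univ_ext
    simp [lintonLeft_univ]
  actionHom_comp f₁ f₂ g₁ g₂ := by
    apply univ_ext
    simp only [Comonad.Coalgebra.comp_f, assoc, lintonRight_univ, lintonLeft_univ_assoc,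
      lintonRight_univ_assoc, comp_actionHomLeft, actionHomRight_comp]
    rw [← action_exchange_assoc]
  actionAssocIso_hom_naturality f g h := by
    rw [← Iso.eq_comp_inv, assoc, ← Iso.inv_comp_eq]
    apply univ_ext
    simp only [Comonad.Coalgebra.comp_f, assoc, lintonRight_univ, lintonLeft_univ_assoc,
      lintonRight_univ_assoc, lintonAssoc_inv_univ, lintonAssoc_inv_univ_assoc]
    have h1 := actionAssocIso_inv_naturality (D := D) f g h.f
    simp only [actionHom_def, actionHomRight_comp, assoc] at h1
    rw [← h1]
    simp only [← actionHomRight_comp_assoc, lintonLeft_univ_assoc, lintonRight_univ, assoc]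
    simp only [actionHomRight_comp, assoc, action_exchange_assoc]
  actionUnitIso_hom_naturality f := by
    rw [← cancel_epi (K.lintonUnit _).inv, Iso.inv_hom_id_assoc,
      ← cancel_mono (K.lintonUnit _).inv, assoc, assoc, Iso.hom_inv_id, comp_id]
    apply univ_ext
    simp only [Comonad.Coalgebra.comp_f, assoc, lintonRight_univ, lintonUnit_inv_univ,
      lintonUnit_inv_univ_assoc]
    simp
  whiskerLeft_actionHomLeft c _ _ f A := by
    rw [← Iso.inv_comp_eq]
    apply univ_ext
    simp only [Comonad.Coalgebra.comp_f, assoc, lintonRight_univ_assoc, lintonLeft_univ,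
      lintonAssoc_inv_univ, lintonAssoc_inv_univ_assoc]
    simp only [← actionHomRight_comp_assoc, lintonLeft_univ]
    simp
  whiskerRight_actionHomLeft c f A := by
    rw [← Iso.inv_comp_eq]
    apply univ_ext
    simp only [Comonad.Coalgebra.comp_f, assoc, lintonLeft_univ_assoc, lintonLeft_univ,
      lintonAssoc_inv_univ, lintonAssoc_inv_univ_assoc]
    rw [← action_exchange_assoc]
    simp
  associator_actionHom c₁ c₂ c₃ A := by
    have h : (K.lintonAssoc c₁ c₂ (K.linton c₃ A)).inv ≫ (K.lintonAssoc (c₁ ⊗ c₂) c₃ A).inv ≫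
        K.lintonLeft (α_ c₁ c₂ c₃).hom A =
        K.lintonRight c₁ (K.lintonAssoc c₂ c₃ A).inv ≫ (K.lintonAssoc c₁ (c₂ ⊗ c₃) A).inv := by
      apply univ_ext
      simp only [Comonad.Coalgebra.comp_f, assoc, lintonRight_univ_assoc, lintonLeft_univ,
        lintonAssoc_inv_univ, lintonAssoc_inv_univ_assoc]
      simp only [← actionHomRight_comp_assoc, lintonAssoc_inv_univ]
      have h := associator_actionHom (D := D) c₁ c₂ c₃ A.A
      have h' : (αₗ c₁ c₂ (c₃ ⊙ₗ A.A)).inv ≫ (αₗ (c₁ ⊗ c₂) c₃ A.A).inv ≫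
          (α_ c₁ c₂ c₃).hom ⊵ₗ A.A =
          c₁ ⊴ₗ (αₗ c₂ c₃ A.A).inv ≫ (αₗ c₁ (c₂ ⊗ c₃) A.A).inv := by
        rw [Iso.inv_comp_eq, Iso.inv_comp_eq, ← reassoc_of% h]
        simp
      simp [h']
    rw [← cancel_epi (K.lintonAssoc (c₁ ⊗ c₂) c₃ A).inv,
      ← cancel_epi (K.lintonAssoc c₁ c₂ (K.linton c₃ A)).inv, reassoc_of% h]
    simp [lintonRight_inv_hom]
  leftUnitor_actionHom c A := by
    rw [← cancel_epi (K.lintonAssoc (𝟙_ C) c A).inv,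
      ← cancel_epi (K.lintonUnit (K.linton c A)).inv, Iso.inv_hom_id_assoc, Iso.inv_hom_id]
    apply univ_ext
    simp only [Comonad.Coalgebra.comp_f, assoc, lintonLeft_univ, lintonAssoc_inv_univ_assoc,
      lintonUnit_inv_univ_assoc]
    simp
  rightUnitor_actionHom c A := by
    have h : K.lintonRight c (K.lintonUnit A).inv ≫ (K.lintonAssoc c (𝟙_ C) A).inv ≫
        K.lintonLeft (ρ_ c).hom A = 𝟙 _ := by
      apply univ_ext
      simp only [Comonad.Coalgebra.comp_f, assoc, lintonLeft_univ, lintonAssoc_inv_univ_assoc,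
        lintonRight_univ_assoc]
      simp only [← actionHomRight_comp_assoc, lintonUnit_inv_univ]
      simp
    have h' := K.lintonRight_inv_hom c (K.lintonUnit A).symm
    dsimp at h'
    rw [← Iso.inv_comp_eq, ← cancel_epi (𝟙 _), ← h', assoc, h, assoc, lintonRight_inv_hom]

end LeftExactComonad
end EilenbergMoore

section Morita

open Functor.OplaxLeftLinear

variable {C : Type u} [Category.{v} C] [MonoidalCategory C]
variable {D : Type u₁} [Category.{v₁} D] [MonoidalLeftAction C D]

/-- An oplax `C`-module `K`-`K'`-bicoact functor: a `K`-`K'`-bicomodule object in the category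
of left exact oplax `C`-module endofunctors of `D`. -/
structure Bicoact (K K' : LeftExactComonad C D) where
  /-- the underlying functor -/
  functor : D ⥤ D
  lex : PreservesFiniteLimits functor
  oplax : functor.OplaxLeftLinear C
  /-- the left coaction, from `F` to `K ∘ F` -/
  la : functor ⟶ functor ⋙ K.toFunctor
  /-- the right coaction, from `F` to `F ∘ K'` -/
  ra : functor ⟶ K'.toFunctor ⋙ functor
  la_mod : IsModuleTransformation C la
  ra_mod : IsModuleTransformation C ra
  la_counit (d : D) : la.app d ≫ K.ε.app (functor.obj d) = 𝟙 _
  la_coassoc (d : D) : la.app d ≫ K.δ.app (functor.obj d) = la.app d ≫ K.map (la.app d)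
  ra_counit (d : D) : ra.app d ≫ functor.map (K'.ε.app d) = 𝟙 _
  ra_coassoc (d : D) :
    ra.app d ≫ functor.map (K'.δ.app d) = ra.app d ≫ ra.app (K'.obj d)
  la_ra (d : D) : la.app d ≫ K.map (ra.app d) = ra.app d ≫ la.app (K'.obj d)

attribute [instance] Bicoact.oplax

/-- The regular bicoact functor `K`, both coactions being the comultiplication. -/
def Bicoact.regular (K : LeftExactComonad C D) : Bicoact K K where
  functor := K.toFunctor
  lex := K.lex
  oplax := K.oplax
  la := K.δ
  ra := K.δ
  la_mod := K.comul_mod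
  ra_mod := K.comul_mod
  la_counit d := K.toComonad.left_counit d
  la_coassoc d := (K.toComonad.coassoc d).symm
  ra_counit d := K.toComonad.right_counit d
  ra_coassoc d := K.toComonad.coassoc d
  la_ra d := K.toComonad.coassoc d

/-- The bicoact functor `H` is (isomorphic to) the cotensor product of `F` and `G` over `K'`:
there is a morphism `j` of bicoact functors from `H` to `F ∘ G` which exhibits `H` as the
equalizer of the two morphisms from `F ∘ G` to `F ∘ K' ∘ G` given by the right coaction of `F`
and the left coaction of `G`. -/
def IsCotensor {K K' K'' : LeftExactComonad C D} (F : Bicoact K K') (G : Bicoact K' K'')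
    (H : Bicoact K K'') : Prop :=
  ∃ j : H.functor ⟶ G.functor ⋙ F.functor,
    IsModuleTransformation C j ∧
    (∀ d : D, j.app d ≫ F.la.app (G.functor.obj d) = H.la.app d ≫ K.map (j.app d)) ∧
    (∀ d : D, j.app d ≫ F.functor.map (G.ra.app d) = H.ra.app d ≫ j.app (K''.obj d)) ∧
    ∀ d : D, ∃ w : j.app d ≫ F.ra.app (G.functor.obj d) = j.app d ≫ F.functor.map (G.la.app d),
      Nonempty (IsLimit (Fork.ofι (j.app d) w))

/-- Morita equivalence of left exact oplax module comonads: there are bicoact functors between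
them whose two cotensor products are the regular bicoact functors. -/
def Morita (K K' : LeftExactComonad C D) : Prop :=
  ∃ (F : Bicoact K K') (G : Bicoact K' K),
    IsCotensor F G (Bicoact.regular K) ∧ IsCotensor G F (Bicoact.regular K')

end Morita

section Pairs

variable (C : Type u) [Category.{v} C] [MonoidalCategory C]

/-- The category `M` is an abelian `C`-module category with enough injectives and with an action
that is left exact in both variables, and `X` is a coclosed `C`-injective `C`-cogenerator. -/
structure IsReconstructionPair {M : Type u₁} [Category.{v₁} M] [MonoidalLeftAction C M]
    (X : M) : Prop where
  abelian : Nonempty (Abelian M)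
  enoughInjectives : EnoughInjectives M
  leftExact : SeparatelyLeftExact C M
  coclosed : (actOn C X).IsRightAdjoint
  injective (I : C) : Injective I → Injective (I ⊙ₗ X)
  cogenerator (J : M) : Injective J → ∃ I : C, Injective I ∧ Nonempty (Retract J (I ⊙ₗ X))

/-- A pair `(M, X)` consisting of an abelian `C`-module category with enough injectives and a
coclosed `C`-injective `C`-cogenerator of it. -/
structure ReconstructionPair where
  /-- the module category -/
  M : Type (max u v)
  [cat : Category.{v} M]
  [act : MonoidalLeftAction C M]
  /-- the cogenerator -/
  X : M
  isPair : IsReconstructionPair C X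

attribute [instance] ReconstructionPair.cat ReconstructionPair.act

/-- Equivalence of `C`-module categories: there is a strong `C`-module functor which is an
equivalence of categories. -/
def ModEquiv (M : Type u₁) [Category.{v₁} M] [MonoidalLeftAction C M]
    (N : Type u₂) [Category.{v₂} N] [MonoidalLeftAction C N] : Prop :=
  ∃ F : M ⥤ N, F.IsEquivalence ∧ Nonempty (F.LeftLinear C)

variable {C}

/-- Two pairs are identified if their module categories are equivalent; the equivalence need not
preserve the cogenerators. -/
def ReconstructionPair.Equivalent (P Q : ReconstructionPair.{v, u} C) : Prop :=
  ModEquiv C P.M Q.M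

end Pairs

end ModCat

set_option linter.unusedSectionVars false

/-! The argument rests on a universal property of the Linton action. Comodule morphisms `B ⟶ c ▶ A`
are the same as multilinear morphisms `B.A ⟶ c ⊙ₗ A.A` in the base, so every question about the
module structure of `K.EM` becomes a question about multilinear morphisms. A functor into `K.EM`
with compatible multilinear morphisms is an oplax module functor, and it is strong once it is full,
essentially surjective and bijective on multilinear morphisms (`MultilinearStructure.isIso_lift`).

From pairs to comonads. Let `L ⊣ - ▷ X`. Since `X` is `C`-injective, the right adjoint preserves
injectives, so `L` preserves monomorphisms; being right exact, it is exact. Since `X` is a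
cogenerator, the unit is a monomorphism, so `L` is conservative. Beck's theorem makes the comparison
functor to comodules an equivalence, and the criterion above makes it strong
(`modEquiv_ofAdjunction`). Hence the module category of a pair is recovered from its comonad.

From comonads to pairs. `K.EM` is abelian with enough injectives because the forgetful functor is
exact and conservative with right adjoint the cofree functor. The isomorphism `c ▶ K d ≅ K (c ▷ d)`
identifies `- ▶ K 𝟙` with the cofree functor, which gives coclosedness, injectivity and cogeneration
together (`isReconstructionPair`).

Morita equivalence (`morita_iff_modEquiv`). A left exact oplax module functor `T` between
Eilenberg–Moore categories yields the bicoact functor forget ∘ `T` ∘ cofree; for mutually inverse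
equivalences, presenting comodules as equalizers of cofree ones shows that the cotensor products are
regular. Conversely, a bicoact functor `F` acts on comodules by `F □ -`; if the cotensor products
with `G` are regular, then `A ≅ F □ (G □ A)`, also compatibly with multilinear morphisms, so `F □ -`
is an equivalence of module categories.

Thus both quotients classify module categories up to equivalence, and the bijection follows
formally: a comonad and the comonad of its pair are compared only through their Eilenberg–Moore
categories. -/

namespace ModCat

/-! ### Strong module functors and mates. -/

section LeftLinearFunctors

variable {C : Type u} [Category.{v} C] [MonoidalCategory C]
variable {D : Type u₁} [Category.{v₁} D] [MonoidalLeftAction C D]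
variable {E : Type u₂} [Category.{v₂} E] [MonoidalLeftAction C E]
variable {E' : Type u₃} [Category.{v₃} E'] [MonoidalLeftAction C E']

open Functor.OplaxLeftLinear Functor.LaxLeftLinear Functor.LeftLinear

/-- An oplax module functor with invertible structure morphisms is a strong module functor. -/
@[reducible] noncomputable def leftLinearOfIsIso (F : D ⥤ E) [F.OplaxLeftLinear C]
    [∀ (c : C) (d : D), IsIso (δₗ F c d)] : F.LeftLinear C where
  μₗ c d := inv (δₗ F c d)
  μₗ_naturality_left f d := by
    rw [IsIso.comp_inv_eq, assoc, IsIso.eq_inv_comp, δₗ_naturality_left]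
  μₗ_naturality_right c _ _ f := by
    rw [IsIso.comp_inv_eq, assoc, IsIso.eq_inv_comp, δₗ_naturality_right]
  μₗ_associativity c c' d := by
    have h := δₗ_associativity F c c' d
    rw [IsIso.inv_comp_eq, ← cancel_mono (δₗ F c (c' ⊙ₗ d)), ← cancel_mono (c ⊴ₗ δₗ F c' d)]
    simp only [assoc, IsIso.inv_hom_id, comp_id]
    rw [← actionHomRight_comp, IsIso.inv_hom_id, actionHomRight_id, comp_id, h]
  μₗ_unitality d := by
    rw [IsIso.eq_inv_comp, δₗ_unitality_hom]
  μₗ_comp_δₗ c d := by simp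
  δₗ_comp_μₗ c d := by simp

/-- The identity is a strong module functor. -/
@[reducible] noncomputable def leftLinearId : (𝟭 D).LeftLinear C :=
  haveI (c : C) (d : D) : IsIso (δₗ (𝟭 D) c d) := inferInstanceAs (IsIso (𝟙 (c ⊙ₗ d)))
  leftLinearOfIsIso (𝟭 D)

/-- Strong module functors compose. -/
@[reducible] noncomputable def leftLinearComp (F : D ⥤ E) (G : E ⥤ E')
    [F.LeftLinear C] [G.LeftLinear C] :
    (F ⋙ G).LeftLinear C :=
  haveI (c : C) (d : D) : IsIso (δₗ (F ⋙ G) c d) :=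
    inferInstanceAs (IsIso (G.map (δₗ F c d) ≫ δₗ G c (F.obj d)))
  leftLinearOfIsIso (F ⋙ G)

variable {L : E ⥤ D} {R : D ⥤ E} (adj : L ⊣ R) [R.LeftLinear C]

/-- This is `unit_mate`, the defining property of the mate, with `μₗ` cancelled against its inverse
`δₗ`. -/
lemma unit_isModuleTransformation :
    letI := oplaxOfAdj (C := C) adj
    IsModuleTransformation C (F := 𝟭 E) (G := L ⋙ R) adj.unit := by
  intro c e
  have h := unit_mate adj c e
  change 𝟙 _ ≫ c ⊴ₗ adj.unit.app e =
    adj.unit.app (c ⊙ₗ e) ≫ R.map (mate adj c e) ≫ δₗ R c (L.obj e)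
  rw [reassoc_of% h]
  simp

lemma counit_isModuleTransformation :
    letI := oplaxOfAdj (C := C) adj
    IsModuleTransformation C (F := R ⋙ L) (G := 𝟭 D) adj.counit :=
  (OplaxModuleComonad.ofAdjunction (C := C) adj).counit_mod

/-- For an equivalence the unit and counit are invertible, hence so is every factor of the mate.
This makes the inverse of a strong equivalence strong. -/
lemma isIso_mate [L.IsEquivalence] [R.IsEquivalence] (c : C) (e : E) :
    IsIso (mate adj c e) := by
  unfold mate
  infer_instance

end LeftLinearFunctors

/-! ### Equivalence of module categories as an equivalence relation. -/

section ModEquiv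

variable {C : Type u} [Category.{v} C] [MonoidalCategory C]
variable {D : Type u₁} [Category.{v₁} D] [MonoidalLeftAction C D]
variable {E : Type u₂} [Category.{v₂} E] [MonoidalLeftAction C E]
variable {E' : Type u₃} [Category.{v₃} E'] [MonoidalLeftAction C E']

variable (C D) in
lemma ModEquiv.refl : ModEquiv C D D :=
  ⟨𝟭 D, inferInstance, ⟨leftLinearId⟩⟩

lemma ModEquiv.trans (h : ModEquiv C D E) (h' : ModEquiv C E E') : ModEquiv C D E' := by
  obtain ⟨F, hF, ⟨_⟩⟩ := h
  obtain ⟨G, hG, ⟨_⟩⟩ := h'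
  exact ⟨F ⋙ G, inferInstance, ⟨leftLinearComp F G⟩⟩

lemma ModEquiv.symm (h : ModEquiv C D E) : ModEquiv C E D := by
  obtain ⟨F, hF, ⟨_⟩⟩ := h
  let adj : F.inv ⊣ F := F.asEquivalence.symm.toAdjunction
  let : F.inv.OplaxLeftLinear C := oplaxOfAdj adj
  have (c : C) (e : E) : IsIso (Functor.OplaxLeftLinear.δₗ F.inv c e) := isIso_mate adj c e
  exact ⟨F.inv, inferInstance, ⟨leftLinearOfIsIso F.inv⟩⟩

end ModEquiv

end ModCat

/-! ### Module functors into the Eilenberg–Moore category from multilinear morphisms. -/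

namespace ModCat

namespace LeftExactComonad

open Functor.OplaxLeftLinear

variable {C : Type u} [Category.{v} C] [MonoidalCategory C]
variable {D : Type u₁} [Category.{v₁} D] [MonoidalLeftAction C D] [HasEqualizers D]
  [SeparatelyLeftExact C D]
variable {M : Type u₂} [Category.{v₂} M] [MonoidalLeftAction C M]
variable {K : LeftExactComonad C D}

variable (K) in
/-- The forgetful functor of the Eilenberg--Moore category is an oplax module functor, with the
universal multilinear morphisms as structure morphisms. -/
noncomputable instance oplaxForget : K.forget.OplaxLeftLinear C where
  δₗ c A := K.univ c A
  δₗ_naturality_left f A := lintonLeft_univ f A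
  δₗ_naturality_right c _ _ g := lintonRight_univ c g
  δₗ_associativity c c' A := by
    have h := lintonAssoc_inv_univ c c' A
    change K.univ (c ⊗ c') A ≫ (αₗ c c' A.A).hom =
      (K.lintonAssoc c c' A).hom.f ≫ K.univ c (K.linton c' A) ≫ c ⊴ₗ K.univ c' A
    rw [← Iso.eq_comp_inv, assoc, assoc, ← h, ← assoc, ← Comonad.Coalgebra.comp_f]
    simp
  δₗ_unitality_inv A := (lintonUnit_inv_univ A).symm

section Lift

variable (K) in
/-- Natural multilinear morphisms `F (c ▷ m) ⟶ c ▷ F m` which make the composite of `F` with the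
forgetful functor into an oplax module functor. -/
structure MultilinearStructure (F : M ⥤ K.EM) where
  /-- the multilinear morphisms -/
  str (c : C) (m : M) : (F.obj (c ⊙ₗ m)).A ⟶ c ⊙ₗ (F.obj m).A
  multilinear (c : C) (m : M) : K.IsMultilinear c (str c m)
  naturality_left {c c' : C} (f : c ⟶ c') (m : M) :
    (F.map (f ⊵ₗ m)).f ≫ str c' m = str c m ≫ f ⊵ₗ (F.obj m).A
  naturality_right (c : C) {m m' : M} (g : m ⟶ m') :
    (F.map (c ⊴ₗ g)).f ≫ str c m' = str c m ≫ c ⊴ₗ (F.map g).f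
  associativity (c c' : C) (m : M) : str (c ⊗ c') m ≫ (αₗ c c' (F.obj m).A).hom =
    (F.map (αₗ c c' m).hom).f ≫ str c (c' ⊙ₗ m) ≫ c ⊴ₗ str c' m
  unitality (m : M) : (λₗ (F.obj m).A).inv = (F.map (λₗ m).inv).f ≫ str (𝟙_ C) m

namespace MultilinearStructure

variable {F : M ⥤ K.EM} (S : K.MultilinearStructure F)

/-- The comodule morphisms `F (c ▷ m) ⟶ c ▶ F m`. -/
noncomputable def lift (c : C) (m : M) : F.obj (c ⊙ₗ m) ⟶ K.linton c (F.obj m) :=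
  LeftExactComonad.lift (S.str c m) (S.multilinear c m)

lemma lift_univ (c : C) (m : M) : (S.lift c m).f ≫ K.univ c (F.obj m) = S.str c m :=
  LeftExactComonad.lift_univ _ _

lemma lift_univ_assoc (c : C) (m : M) {Z : D} (h : c ⊙ₗ (F.obj m).A ⟶ Z) :
    (S.lift c m).f ≫ K.univ c (F.obj m) ≫ h = S.str c m ≫ h :=
  LeftExactComonad.lift_univ_assoc _ _ _

/-- A functor to the Eilenberg--Moore category with a multilinear structure is an oplax module
functor. -/
@[reducible] noncomputable def oplax : F.OplaxLeftLinear C where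
  δₗ c m := S.lift c m
  δₗ_naturality_left {c c'} f m := by
    change F.map (f ⊵ₗ m) ≫ S.lift c' m = S.lift c m ≫ K.lintonLeft f (F.obj m)
    apply univ_ext
    simp only [Comonad.Coalgebra.comp_f, assoc, lintonLeft_univ, lift_univ, lift_univ_assoc,
      S.naturality_left]
  δₗ_naturality_right c m m' g := by
    change F.map (c ⊴ₗ g) ≫ S.lift c m' = S.lift c m ≫ K.lintonRight c (F.map g)
    apply univ_ext
    simp only [Comonad.Coalgebra.comp_f, assoc, lintonRight_univ, lift_univ, lift_univ_assoc,
      S.naturality_right]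
  δₗ_associativity c c' m := by
    change S.lift (c ⊗ c') m ≫ (K.lintonAssoc c c' (F.obj m)).hom =
      F.map (αₗ c c' m).hom ≫ S.lift c (c' ⊙ₗ m) ≫ K.lintonRight c (S.lift c' m)
    rw [← Iso.eq_comp_inv]
    apply univ_ext
    have h := S.associativity c c' m
    rw [← Iso.eq_comp_inv] at h
    simp only [Comonad.Coalgebra.comp_f, assoc, lift_univ, lintonAssoc_inv_univ]
    rw [lintonRight_univ_assoc, lift_univ_assoc, ← actionHomRight_comp_assoc, lift_univ, h,
      assoc, assoc]
  δₗ_unitality_inv m := by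
    change (K.lintonUnit (F.obj m)).inv = F.map (λₗ m).inv ≫ S.lift (𝟙_ C) m
    apply univ_ext
    rw [Comonad.Coalgebra.comp_f, assoc, lift_univ, lintonUnit_inv_univ, S.unitality]

/-- An essentially surjective full functor to the Eilenberg--Moore category which induces
bijections onto multilinear morphisms is a strong module functor. -/
lemma isIso_lift [F.Full] [F.EssSurj]
    (hex : ∀ (c : C) (n m : M) (f : (F.obj n).A ⟶ c ⊙ₗ (F.obj m).A), K.IsMultilinear c f →
      ∃ g : n ⟶ c ⊙ₗ m, (F.map g).f ≫ S.str c m = f)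
    (hinj : ∀ (c : C) (n m : M) (g g' : n ⟶ c ⊙ₗ m),
      (F.map g).f ≫ S.str c m = (F.map g').f ≫ S.str c m → g = g') (c : C) (m : M) :
    IsIso (S.lift c m) := by
  -- Surjectivity, applied to the universal multilinear morphism transported to a preimage of `c ▶ F
  -- m`, produces a one-sided inverse. The other composite is some `F.map k` by fullness, and
  -- injectivity forces `k = 𝟙`.
  let e := F.objObjPreimageIso (K.linton c (F.obj m))
  obtain ⟨g, hg⟩ := hex c _ m _ (isMultilinear_univ.precomp e.hom)
  have h1 : F.map g ≫ S.lift c m = e.hom := by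
    apply univ_ext
    rw [Comonad.Coalgebra.comp_f, assoc, lift_univ, hg]
  refine ⟨e.inv ≫ F.map g, ?_, ?_⟩
  · obtain ⟨k, hk⟩ := F.map_surjective (S.lift c m ≫ e.inv ≫ F.map g)
    have h2 : k = 𝟙 _ := by
      apply hinj
      have h5 : e.inv.f ≫ e.hom.f = 𝟙 _ := by
        rw [← Comonad.Coalgebra.comp_f, e.inv_hom_id, Comonad.Coalgebra.id_f]
      simp only [hk, F.map_id, Comonad.Coalgebra.comp_f, assoc, hg, reassoc_of% h5, lift_univ,
        Comonad.Coalgebra.id_f, id_comp]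
    rw [← hk, h2, F.map_id]
  · rw [assoc, h1, e.inv_hom_id]

end MultilinearStructure

end Lift

/-! ### The action on cofree comodules. -/

section Cofree

variable (K) in
/-- The morphisms `K (c ▷ d) ⟶ c ▷ K d`, as a multilinear structure on the cofree functor. -/
def cofreeStructure : K.MultilinearStructure (M := D) K.cofree where
  str c d := K.str c d
  multilinear c d := (K.str_comul c d).symm
  naturality_left f d := K.oplax.δₗ_naturality_left f d
  naturality_right c _ _ g := K.oplax.δₗ_naturality_right c g
  associativity c c' d := K.oplax.δₗ_associativity c c' d
  unitality d := K.oplax.δₗ_unitality_inv d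

variable (K) in
/-- The cofree comodule functor is an oplax module functor. -/
noncomputable instance oplaxCofree : K.cofree.OplaxLeftLinear C :=
  K.cofreeStructure.oplax

lemma δ_cofree_univ (c : C) (d : D) :
    (δₗ K.cofree c d).f ≫ K.univ c (K.cofree.obj d) = K.str c d :=
  K.cofreeStructure.lift_univ c d

variable (K) in
/-- The cofree comodule `K d`. -/
abbrev cofreeObj (d : D) : K.EM where
  A := K.obj d
  a := K.δ.app d
  counit := (K.cofree.obj d).counit
  coassoc := (K.cofree.obj d).coassoc

variable (K) in
/-- The morphism `K (c ▷ d) ⟶ c ▶ K d` induced by the structure morphism. -/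
noncomputable def cofreeLinton (c : C) (d : D) :
    K.cofreeObj (c ⊙ₗ d) ⟶ K.linton c (K.cofreeObj d) :=
  lift (K.str c d) (K.str_comul c d).symm

lemma cofreeLinton_univ (c : C) (d : D) :
    (K.cofreeLinton c d).f ≫ K.univ c (K.cofreeObj d) = K.str c d :=
  lift_univ _ _

variable (K) in
/-- The morphism `c ▶ K d ⟶ K (c ▷ d)`. -/
noncomputable def lintonCofree (c : C) (d : D) :
    K.linton c (K.cofreeObj d) ⟶ K.cofreeObj (c ⊙ₗ d) where
  -- The transpose, under the cofree adjunction, of `c ▶ K d ⟶ c ▷ K d ⟶ c ▷ d`.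
  f := K.incl c (K.cofreeObj d) ≫ K.map (c ⊴ₗ K.ε.app d)
  h := by
    have h1 := K.coact_incl c (K.cofreeObj d)
    have h2 := Comonad.delta_naturality _ K.toComonad (c ⊴ₗ K.ε.app d)
    rw [Functor.map_comp, reassoc_of% h1, assoc]
    exact congrArg (_ ≫ ·) h2.symm

variable (K) in
/-- The comodule `c ▶ K d` is the cofree comodule `K (c ▷ d)`. -/
noncomputable def cofreeIso (c : C) (d : D) :
    K.cofreeObj (c ⊙ₗ d) ≅ K.linton c (K.cofreeObj d) where
  hom := K.cofreeLinton c d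
  inv := K.lintonCofree c d
  hom_inv_id := by
    ext
    have h1 := (K.cofreeLinton c d).h
    change (K.cofreeLinton c d).f ≫ K.incl c (K.cofreeObj d) ≫ K.map (c ⊴ₗ K.ε.app d) =
      𝟙 (K.obj (c ⊙ₗ d))
    rw [← coact_univ, assoc, ← reassoc_of% h1, ← Functor.map_comp_assoc, cofreeLinton_univ,
      ← Functor.map_comp, K.str_counit]
    exact K.toComonad.right_counit _
  inv_hom_id := by
    apply univ_ext
    have h1 : K.IsMultilinear c (K.univ c (K.cofreeObj d)) := isMultilinear_univ
    have h2 : K.map (c ⊴ₗ K.ε.app d) ≫ K.str c d = K.str c (K.obj d) ≫ c ⊴ₗ K.map (K.ε.app d) :=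
      δₗ_naturality_right K.toFunctor c (K.ε.app d)
    have h4 := K.toComonad.right_counit d
    rw [Comonad.Coalgebra.comp_f, assoc, cofreeLinton_univ]
    dsimp only [IsMultilinear, str, lintonCofree] at h1 h2 ⊢
    rw [assoc, h2, ← coact_univ, assoc, reassoc_of% h1, ← actionHomRight_comp, h4]
    simp

end Cofree

end LeftExactComonad

end ModCat

namespace ModCat

/-! ### The comparison functor as an equivalence of module categories. -/

section Comparison

open Functor.OplaxLeftLinear Functor.LaxLeftLinear Functor.LeftLinear

variable {C : Type u} [Category.{v} C] [MonoidalCategory C]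
variable {D : Type u₁} [Category.{v₁} D] [MonoidalLeftAction C D]
variable {M : Type u₂} [Category.{v₁} M] [MonoidalLeftAction C M]
variable {L : M ⥤ D} {R : D ⥤ M} (adj : L ⊣ R) [R.LeftLinear C]

/-- Since `L.map (adj.unit.app m)` is the coaction on the comparison comodule of `m`, this is
exactly multilinearity of the mate. -/
lemma mate_multilinear (c : C) (m : M) :
    L.map (adj.unit.app (c ⊙ₗ m)) ≫ L.map (R.map (mate adj c m)) ≫
      L.map (δₗ R c (L.obj m)) ≫ mate adj c (R.obj (L.obj m)) =
    mate adj c m ≫ c ⊴ₗ L.map (adj.unit.app m) := by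
  have h' := mate_naturality_right adj c (adj.unit.app m)
  dsimp at h'
  rw [← h', ← L.map_comp_assoc, unit_mate, ← L.map_comp_assoc]
  simp

/-- The left exact oplax module comonad of an adjunction whose right adjoint is a strong module
functor. -/
def LeftExactComonad.ofAdjunction
    (h : PreservesFiniteLimits (OplaxModuleComonad.ofAdjunction (C := C) adj).toFunctor) :
    LeftExactComonad C D :=
  ⟨OplaxModuleComonad.ofAdjunction (C := C) adj, h⟩

/-- The comparison functor to the comodules over the comonad of an adjunction whose right adjoint
is a strong module functor. -/
noncomputable def comparison
    (h : PreservesFiniteLimits (OplaxModuleComonad.ofAdjunction (C := C) adj).toFunctor) :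
    M ⥤ (LeftExactComonad.ofAdjunction adj h).EM :=
  Comonad.comparison adj

/-- The mates as a multilinear structure on the comparison functor. -/
noncomputable def comparisonStructure
    (h : PreservesFiniteLimits (OplaxModuleComonad.ofAdjunction (C := C) adj).toFunctor) :
    LeftExactComonad.MultilinearStructure _ (comparison adj h) where
  str c m := mate adj c m
  multilinear c m := mate_multilinear adj c m
  naturality_left f m := (oplaxOfAdj (C := C) adj).δₗ_naturality_left f m
  naturality_right c _ _ g := (oplaxOfAdj (C := C) adj).δₗ_naturality_right c g
  associativity c c' m := (oplaxOfAdj (C := C) adj).δₗ_associativity c c' m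
  unitality m := (oplaxOfAdj (C := C) adj).δₗ_unitality_inv m

variable [HasEqualizers M] [PreservesFiniteLimits L] [L.ReflectsIsomorphisms]

/-- The unit of the adjunction exhibits `m` as an equalizer. -/
noncomputable def unitForkIsLimit (m : M) :
    IsLimit (Fork.ofι (f := R.map (L.map (adj.unit.app m))) (g := adj.unit.app (R.obj (L.obj m)))
      (adj.unit.app m) (adj.unit_naturality _)) := by
  -- A functor that preserves an existing limit and reflects isomorphisms also reflects it; this is
  -- the coreflection condition in Beck's theorem.
  have : ReflectsLimit (parallelPair (R.map (L.map (adj.unit.app m)))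
      (adj.unit.app (R.obj (L.obj m)))) L := reflectsLimit_of_reflectsIsomorphisms _ _
  exact Comonad.ComonadicityInternal.unitEqualizerOfCoreflectsEqualizer adj m

lemma mono_unit_app (m : M) : Mono (adj.unit.app m) :=
  mono_of_isLimit_fork (unitForkIsLimit adj m)

variable [SeparatelyLeftExact C M]

/-- The transpose of `L.map g ≫ mate adj c m` is `g` followed by `c ⊴ₗ adj.unit.app m` and an
isomorphism, and `c ⊙ₗ -` keeps the unit a monomorphism. -/
lemma map_comp_mate_injective {c : C} {n m : M} {g g' : n ⟶ c ⊙ₗ m}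
    (h : L.map g ≫ mate adj c m = L.map g' ≫ mate adj c m) : g = g' := by
  have := mono_unit_app adj m
  have : Mono (c ⊴ₗ adj.unit.app m) := inferInstanceAs (Mono ((actionLeft M c).map _))
  have key (g : n ⟶ c ⊙ₗ m) : g ≫ c ⊴ₗ adj.unit.app m ≫ μₗ R c (L.obj m) =
      adj.unit.app n ≫ R.map (L.map g ≫ mate adj c m) := by
    have h2 := adj.unit_naturality g
    dsimp only [Functor.comp_obj, Functor.id_obj] at h2 ⊢
    rw [← unit_mate, R.map_comp, reassoc_of% h2]
  rw [← cancel_mono (c ⊴ₗ adj.unit.app m), ← cancel_mono (μₗ R c (L.obj m)), assoc, assoc, key, h,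
    ← key]

/-- The functor `c ⊙ₗ -` preserves the equalizer presenting `m` through the unit. Multilinearity of
`f` says that its transpose, read in `c ⊙ₗ R (L m)`, equalizes the two morphisms, so it factors
through `c ⊙ₗ m`. -/
lemma exists_map_comp_mate {c : C} {n m : M} (f : L.obj n ⟶ c ⊙ₗ L.obj m)
    (hf : L.map (adj.unit.app n) ≫ L.map (R.map f) ≫
      L.map (δₗ R c (L.obj m)) ≫ mate adj c (R.obj (L.obj m)) =
        f ≫ c ⊴ₗ L.map (adj.unit.app m)) :
    ∃ g : n ⟶ c ⊙ₗ m, L.map g ≫ mate adj c m = f := by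
  have hl := isLimitForkMapOfIsLimit (actionLeft M c) _ (unitForkIsLimit adj m)
  have h1 : (adj.unit.app n ≫ R.map f ≫ δₗ R c (L.obj m)) ≫
        c ⊴ₗ R.map (L.map (adj.unit.app m)) =
      (adj.unit.app n ≫ R.map f ≫ δₗ R c (L.obj m)) ≫
        c ⊴ₗ adj.unit.app (R.obj (L.obj m)) := by
    rw [← cancel_mono (μₗ R c (L.obj (R.obj (L.obj m))))]
    simp only [assoc]
    have h3 : c ⊴ₗ R.map (L.map (adj.unit.app m)) ≫ μₗ R c (L.obj (R.obj (L.obj m))) =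
      μₗ R c (L.obj m) ≫ R.map (c ⊴ₗ L.map (adj.unit.app m)) := μₗ_naturality_right R c _
    rw [h3, ← unit_mate]
    have h2 := adj.unit_naturality (adj.unit.app n ≫ R.map f ≫ δₗ R c (L.obj m))
    simp only [assoc] at h2
    rw [← reassoc_of% h2, ← R.map_comp, L.map_comp, L.map_comp, assoc, assoc, hf]
    simp
  obtain ⟨g, hg⟩ : ∃ g : n ⟶ c ⊙ₗ m, g ≫ c ⊴ₗ adj.unit.app m =
      adj.unit.app n ≫ R.map f ≫ δₗ R c (L.obj m) :=
    ⟨Fork.IsLimit.lift hl _ h1, Fork.IsLimit.lift_ι hl⟩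
  refine ⟨g, ?_⟩
  apply (adj.homEquiv _ _).injective
  have h2 := adj.unit_naturality g
  rw [adj.homEquiv_unit, adj.homEquiv_unit, R.map_comp, reassoc_of% h2, unit_mate,
    reassoc_of% hg]
  simp

/-- The comparison functor of a left exact conservative left adjoint of a strong module functor is
an equivalence of module categories. -/
lemma modEquiv_ofAdjunction [HasEqualizers D] [SeparatelyLeftExact C D]
    (h : PreservesFiniteLimits (OplaxModuleComonad.ofAdjunction (C := C) adj).toFunctor) :
    ModEquiv C M
      (LeftExactComonad.ofAdjunction adj h).EM := by
  have : (comparison adj h).IsEquivalence := by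
    have : Comonad.PreservesLimitOfIsCoreflexivePair L := ⟨fun _ _ _ => inferInstance⟩
    exact (Comonad.comonadicOfHasPreservesCoreflexiveEqualizersOfReflectsIsomorphisms adj).eqv
  let S := comparisonStructure adj h
  let : (comparison adj h).OplaxLeftLinear C := S.oplax
  have (c : C) (m : M) : IsIso (δₗ (comparison adj h) c m) :=
    S.isIso_lift (fun c n m f hf => exists_map_comp_mate adj f hf)
      (fun c n m g g' hg => map_comp_mate_injective adj hg) c m
  exact ⟨comparison adj h, inferInstance, ⟨leftLinearOfIsIso _⟩⟩

end Comparison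

/-! ### Exactness and conservativity of the left adjoint of a pair. -/

section CoclosedCogenerator

variable {C : Type u} [Category.{v} C] [Abelian C] [MonoidalCategory C]
  [EnoughInjectives C]
variable {M : Type u₁} [Category.{v₁} M] [MonoidalLeftAction C M]

variable {X : M} {L : M ⥤ C} (adj : L ⊣ actOn C X)

/-- `C`-injectivity of `X` says that the right adjoint preserves injectives, so `L` preserves
monomorphisms. As a left adjoint, `L` is additive and right exact, and these properties together
give left exactness. -/
lemma IsReconstructionPair.preservesFiniteLimits (adj : L ⊣ actOn C X)
    (hX : IsReconstructionPair C X) :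
    PreservesFiniteLimits L := by
  obtain ⟨_⟩ := hX.abelian
  have : (actOn C X).PreservesInjectiveObjects := ⟨fun {I} hI => hX.injective I hI⟩
  have : L.PreservesMonomorphisms :=
    L.preservesMonomorphisms_of_adjunction_of_preservesInjectiveObjects adj
  have : PreservesColimits L := adj.leftAdjoint_preservesColimits
  have : L.PreservesZeroMorphisms := inferInstance
  have := preservesBinaryBiproducts_of_preservesBinaryCoproducts L
  have : L.Additive := Functor.additive_of_preservesBinaryBiproducts L
  have hL := (Functor.preservesFiniteColimits_iff_forall_exact_map_and_epi L).1 inferInstance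
  exact (Functor.preservesFiniteLimits_iff_forall_exact_map_and_mono L).2 fun S hS =>
    ⟨(hL S hS).1, have := hS.mono_f; inferInstance⟩

/-- By cogeneration each `m` embeds into some `I ⊙ₗ X`. Such an embedding factors through the unit
at `m`, which is therefore a monomorphism; hence `L` is faithful, and a faithful functor out of an
abelian category reflects isomorphisms. -/
lemma IsReconstructionPair.reflectsIsomorphisms (adj : L ⊣ actOn C X)
    (hX : IsReconstructionPair C X) :
    L.ReflectsIsomorphisms := by
  obtain ⟨_⟩ := hX.abelian
  have := hX.enoughInjectives
  have (m : M) : Mono (adj.unit.app m) := by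
    obtain ⟨I, -, ⟨r⟩⟩ := hX.cogenerator (Injective.under m) inferInstance
    let f : m ⟶ (actOn C X).obj I := Injective.ι m ≫ r.i
    have hf : Mono f := have := r.splitMono.mono; mono_comp (Injective.ι m) r.i
    have h : adj.unit.app m ≫ (actOn C X).map ((adj.homEquiv _ I).symm f) = f :=
      (adj.homEquiv_unit _ _ _).symm.trans ((adj.homEquiv _ I).apply_symm_apply f)
    have : Mono (adj.unit.app m ≫ (actOn C X).map ((adj.homEquiv _ I).symm f)) := h.symm ▸ hf
    exact mono_of_mono _ ((actOn C X).map ((adj.homEquiv _ I).symm f))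
  have : L.Faithful := adj.faithful_L_of_mono_unit_app
  infer_instance

end CoclosedCogenerator

end ModCat

namespace ModCat

/-! ### Transfer of abelianness and left exactness. -/

section Exactness

variable {A : Type u₁} [Category.{v₁} A] {B : Type u₂} [Category.{v₂} B]

/-- A preadditive category with an exact conservative functor to an abelian category is abelian. -/
@[reducible] noncomputable def abelianOfExactConservative [Preadditive A] [HasFiniteProducts A]
    [HasKernels A] [HasCokernels A] [Abelian B] (F : A ⥤ B) [F.PreservesZeroMorphisms]
    [PreservesFiniteLimits F] [PreservesFiniteColimits F] [F.ReflectsIsomorphisms] : Abelian A := by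
  have : ∀ {X Y : A} (f : X ⟶ Y), IsIso (Abelian.coimageImageComparison f) := by
    intro X Y f
    -- Exactness identifies this with the comparison morphism of `F.map f`, which is invertible in
    -- `B`.
    have : IsIso (F.map (Abelian.coimageImageComparison f)) := by
      rw [Arrow.isIso_iff_isIso_of_isIso (Abelian.PreservesCoimageImageComparison.iso F f).hom]
      infer_instance
    exact isIso_of_reflects_iso _ F
  exact Abelian.ofCoimageImageComparisonIsIso

/-- The pointwise equalizer of two natural transformations between left exact functors is left
exact. -/
lemma preservesFiniteLimits_of_isLimit_fork {H P Q : A ⥤ B} [PreservesFiniteLimits P]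
    [PreservesFiniteLimits Q] (ι : H ⟶ P) (α β : P ⟶ Q)
    (w : ∀ a, ι.app a ≫ α.app a = ι.app a ≫ β.app a)
    (h : ∀ a, IsLimit (Fork.ofι (ι.app a) (w a))) : PreservesFiniteLimits H where
  preservesFiniteLimits J _ _ := ⟨fun {F} => ⟨fun {c} hc => by
    have hP := isLimitOfPreserves P hc
    have hQ := isLimitOfPreserves Q hc
    have hm (a : A) : Mono (ι.app a) := mono_of_isLimit_fork (h a)
    refine ⟨IsLimit.ofExistsUnique fun s => ?_⟩
    -- The cone is pushed into `P` and lifted there. The limit cone of `Q` shows that the lift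
    -- equalizes `α` and `β`, so it descends to `H`.
    let t : Cone (F ⋙ P) := ⟨s.pt, s.π ≫ Functor.whiskerLeft F ι⟩
    have ht (j : J) : hP.lift t ≫ P.map (c.π.app j) = s.π.app j ≫ ι.app (F.obj j) := hP.fac t j
    have e : hP.lift t ≫ α.app c.pt = hP.lift t ≫ β.app c.pt := by
      refine hQ.hom_ext fun j => ?_
      change (_ ≫ _) ≫ Q.map (c.π.app j) = (_ ≫ _) ≫ Q.map (c.π.app j)
      rw [assoc, assoc, ← α.naturality, ← β.naturality, reassoc_of% (ht j), reassoc_of% (ht j), w]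
    obtain ⟨k, hk⟩ : ∃ k : s.pt ⟶ H.obj c.pt, k ≫ ι.app c.pt = hP.lift t :=
      ⟨Fork.IsLimit.lift (h c.pt) _ e, Fork.IsLimit.lift_ι (h c.pt)⟩
    refine ⟨k, fun j => ?_, fun l hl' => ?_⟩
    · rw [← cancel_mono (ι.app (F.obj j)), ← ht j, ← hk, assoc, assoc]
      exact congrArg (_ ≫ ·) (ι.naturality _)
    · rw [← cancel_mono (ι.app c.pt), hk]
      refine hP.hom_ext fun j => ?_
      have h1 : l ≫ H.map (c.π.app j) = s.π.app j := hl' j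
      refine Eq.trans ?_ (ht j).symm
      change (l ≫ ι.app c.pt) ≫ P.map (c.π.app j) = _
      rw [assoc, ← ι.naturality, reassoc_of% h1]⟩⟩

end Exactness

namespace LeftExactComonad

open Functor.OplaxLeftLinear

/-! ### The Eilenberg–Moore category is abelian with enough injectives. -/

section Abelian

variable {C : Type u} [Category.{v} C] [MonoidalCategory C]
variable {D : Type u₁} [Category.{v₁} D] [MonoidalLeftAction C D]
variable (K : LeftExactComonad C D)

noncomputable instance [HasFiniteLimits D] : CreatesFiniteLimits K.forget where
  createsFiniteLimits J _ _ := inferInstanceAs (CreatesLimitsOfShape J K.toComonad.forget)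

instance [HasFiniteLimits D] : HasFiniteLimits K.EM where
  out _ _ _ := ⟨fun F => hasLimit_of_created F K.toComonad.forget⟩

instance [HasFiniteColimits D] : HasFiniteColimits K.EM where
  out _ _ _ := ⟨fun F => hasColimit_of_created F K.toComonad.forget⟩

instance [HasFiniteLimits D] : PreservesFiniteLimits K.forget where
  preservesFiniteLimits _ _ _ := inferInstance

variable [Abelian D]

/-- The Eilenberg--Moore category of a left exact comonad is abelian. -/
@[reducible] noncomputable def abelianEM : Abelian K.EM :=
  have : K.toFunctor.Additive := Functor.additive_of_preserves_binary_products _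
  have : PreservesColimitsOfSize.{0, 0} K.forget := K.adj.leftAdjoint_preservesColimits
  abelianOfExactConservative K.forget

/-- The cofree functor carries injectives to injectives, and a comodule embeds into the cofree
comodule on an injective containing its underlying object. -/
lemma enoughInjectives_EM [EnoughInjectives D] : EnoughInjectives K.EM :=
  EnoughInjectives.of_adjunction K.adj

end Abelian

/-! ### Left exactness of the Linton action. -/

section Linton

variable {C : Type u} [Category.{v} C] [MonoidalCategory C]
variable {D : Type u₁} [Category.{v₁} D] [MonoidalLeftAction C D] [HasFiniteLimits D]
  [SeparatelyLeftExact C D]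
variable (K : LeftExactComonad C D)

lemma lintonRight_incl (c : C) {A A' : K.EM} (g : A ⟶ A') :
    (K.lintonRight c g).f ≫ K.incl c A' = K.incl c A ≫ K.map (c ⊴ₗ g.f) := by
  rw [← coact_univ, ← coact_univ, ← Comonad.Coalgebra.Hom.h_assoc, ← Functor.map_comp,
    lintonRight_univ, Functor.map_comp, assoc]

lemma lintonLeft_incl {c c' : C} (f : c ⟶ c') (A : K.EM) :
    (K.lintonLeft f A).f ≫ K.incl c' A = K.incl c A ≫ K.map (f ⊵ₗ A.A) := by
  rw [← coact_univ, ← coact_univ, ← Comonad.Coalgebra.Hom.h_assoc, ← Functor.map_comp,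
    lintonLeft_univ, Functor.map_comp, assoc]

/-- After forgetting, `c ▶ -` is by construction a pointwise equalizer of left exact functors, and
the forgetful functor reflects finite limits. -/
instance (c : C) : PreservesFiniteLimits (actionLeft K.EM c) := by
  have : PreservesFiniteLimits (actionLeft K.EM c ⋙ K.forget) := by
    let P : K.EM ⥤ D := K.forget ⋙ actionLeft D c ⋙ K.toFunctor
    let Q : K.EM ⥤ D := K.forget ⋙ K.toFunctor ⋙ actionLeft D c ⋙ K.toFunctor
    let ι : actionLeft K.EM c ⋙ K.forget ⟶ P :=
      { app A := K.incl c A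
        naturality _ _ g := K.lintonRight_incl c g }
    let α : P ⟶ Q :=
      { app A := K.map (c ⊴ₗ A.a)
        naturality A A' g := by
          change K.map (c ⊴ₗ g.f) ≫ K.map (c ⊴ₗ A'.a) =
            K.map (c ⊴ₗ A.a) ≫ K.map (c ⊴ₗ K.map g.f)
          rw [← Functor.map_comp, ← Functor.map_comp, ← actionHomRight_comp,
            ← actionHomRight_comp, g.h] }
    let β : P ⟶ Q :=
      { app A := K.δ.app (c ⊙ₗ A.A) ≫ K.map (K.str c A.A)
        naturality A A' g := by
          have h1 := Comonad.delta_naturality _ K.toComonad (c ⊴ₗ g.f)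
          have h2 := δₗ_naturality_right K.toFunctor c g.f
          change K.map (c ⊴ₗ g.f) ≫ K.δ.app (c ⊙ₗ A'.A) ≫ K.map (K.str c A'.A) =
            (K.δ.app (c ⊙ₗ A.A) ≫ K.map (K.str c A.A)) ≫ K.map (c ⊴ₗ K.map g.f)
          rw [reassoc_of% h1, assoc, ← Functor.map_comp, ← Functor.map_comp, h2] }
    exact preservesFiniteLimits_of_isLimit_fork ι α β (fun A => K.incl_condition c A)
      fun A => equalizerIsEqualizer _ _
  exact preservesFiniteLimits_of_reflects_of_preserves _ K.forget

/-- The same defining equalizer, now viewed as a functor of `c` with `A` fixed. -/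
instance (A : K.EM) : PreservesFiniteLimits (actOn C A) := by
  have : PreservesFiniteLimits (actOn C A ⋙ K.forget) := by
    let P : C ⥤ D := actOn C A.A ⋙ K.toFunctor
    let Q : C ⥤ D := actOn C (K.obj A.A) ⋙ K.toFunctor
    let ι : actOn C A ⋙ K.forget ⟶ P :=
      { app c := K.incl c A
        naturality _ _ f := K.lintonLeft_incl f A }
    let α : P ⟶ Q :=
      { app c := K.map (c ⊴ₗ A.a)
        naturality c c' f := by
          change K.map (f ⊵ₗ A.A) ≫ K.map (c' ⊴ₗ A.a) = K.map (c ⊴ₗ A.a) ≫ K.map (f ⊵ₗ K.obj A.A)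
          rw [← Functor.map_comp, ← Functor.map_comp, action_exchange] }
    let β : P ⟶ Q :=
      { app c := K.δ.app (c ⊙ₗ A.A) ≫ K.map (K.str c A.A)
        naturality c c' f := by
          have h1 := Comonad.delta_naturality _ K.toComonad (f ⊵ₗ A.A)
          have h2 := δₗ_naturality_left K.toFunctor f A.A
          change K.map (f ⊵ₗ A.A) ≫ K.δ.app (c' ⊙ₗ A.A) ≫ K.map (K.str c' A.A) =
            (K.δ.app (c ⊙ₗ A.A) ≫ K.map (K.str c A.A)) ≫ K.map (f ⊵ₗ K.obj A.A)
          rw [reassoc_of% h1, assoc, ← Functor.map_comp, ← Functor.map_comp, h2] }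
    exact preservesFiniteLimits_of_isLimit_fork ι α β (fun c => K.incl_condition c A)
      fun c => equalizerIsEqualizer _ _
  exact preservesFiniteLimits_of_reflects_of_preserves _ K.forget

instance : SeparatelyLeftExact C K.EM where
  left := inferInstance
  right := inferInstance

end Linton

/-! ### The cofree comodule on the unit as a reconstruction pair. -/

section Pair

variable {C : Type u} [Category.{v} C] [Abelian C] [MonoidalCategory C]
  [SeparatelyLeftExact C C]
variable (K : LeftExactComonad C C)

/-- The functor `- ▶ K 𝟙` is the cofree functor. -/
noncomputable def cofreeIsoActOn : K.cofree ≅ actOn C (K.cofree.obj (𝟙_ C)) :=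
  NatIso.ofComponents
    -- `K c ≅ K (c ⊗ 𝟙) ≅ c ▶ K 𝟙`.
    (fun c => K.cofree.mapIso (ρ_ c).symm ≪≫ K.cofreeIso c (𝟙_ C))
    (fun {c c'} f => by
      have h := δₗ_naturality_left K.cofree f (𝟙_ C)
      have h' : K.cofree.map f ≫ K.cofree.map (ρ_ c').inv =
          K.cofree.map (ρ_ c).inv ≫ K.cofree.map (f ▷ 𝟙_ C) := by
        rw [← Functor.map_comp, ← Functor.map_comp, rightUnitor_inv_naturality]
      change K.cofree.map f ≫ K.cofree.map (ρ_ c').inv ≫ δₗ K.cofree c' (𝟙_ C) =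
        (K.cofree.map (ρ_ c).inv ≫ δₗ K.cofree c (𝟙_ C)) ≫ f ⊵ₗ K.cofree.obj (𝟙_ C)
      rw [reassoc_of% h', assoc, ← h]
      rfl)

variable [EnoughInjectives C]

/-- The transpose of an embedding of `J.A` into an injective is a monomorphism from `J` to a cofree
comodule, and it splits because `J` is injective. -/
lemma exists_retract_cofree (J : K.EM) [Injective J] :
    ∃ I : C, Injective I ∧ Nonempty (Retract J (K.cofree.obj I)) := by
  refine ⟨Injective.under J.A, inferInstance, ?_⟩
  let i : J ⟶ K.cofree.obj (Injective.under J.A) := K.adj.homEquiv _ _ (Injective.ι J.A)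
  have h : i.f ≫ K.adj.counit.app _ = Injective.ι J.A :=
    (K.adj.homEquiv_counit _ _ _).symm.trans
      ((K.adj.homEquiv _ _).symm_apply_apply (Injective.ι J.A))
  have : Mono (i.f ≫ K.adj.counit.app _) := h.symm ▸ inferInstanceAs (Mono (Injective.ι J.A))
  have : Mono i.f := mono_of_mono i.f (K.adj.counit.app _)
  have : Mono i := Comonad.algebra_mono_of_mono _ i
  exact ⟨⟨i, Injective.factorThru (𝟙 J) i, Injective.comp_factorThru _ _⟩⟩

/-- The cofree comodule `K 𝟙` is a coclosed injective cogenerator. -/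
lemma isReconstructionPair : IsReconstructionPair C (M := K.EM) (K.cofree.obj (𝟙_ C)) where
  abelian := ⟨K.abelianEM⟩
  enoughInjectives := K.enoughInjectives_EM
  leftExact := inferInstance
  coclosed := by
    have : K.cofree.IsRightAdjoint := K.adj.isRightAdjoint
    exact Functor.isRightAdjoint_of_iso K.cofreeIsoActOn
  injective I hI :=
    have : Injective (K.cofree.obj I) := Injective.injective_of_adjoint K.adj I
    Injective.of_iso (K.cofreeIsoActOn.app I) this
  cogenerator J hJ := by
    obtain ⟨I, hI, ⟨r⟩⟩ := K.exists_retract_cofree J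
    exact ⟨I, hI, ⟨r.trans (Retract.ofIso (K.cofreeIsoActOn.app I))⟩⟩

end Pair

end LeftExactComonad

end ModCat

namespace ModCat

/-! ### Equalizer manipulations and presentations by cofree comodules. -/

section Forks

variable {A : Type u₁} [Category.{v₁} A]

/-- The fork with the two parallel morphisms exchanged. -/
def forkSwap {X Y Z : A} {f g : X ⟶ Y} {ι : Z ⟶ X} {w : ι ≫ f = ι ≫ g}
    (h : IsLimit (Fork.ofι ι w)) : IsLimit (Fork.ofι ι w.symm) :=
  Fork.IsLimit.mk' _ fun s => ⟨Fork.IsLimit.lift h s.ι s.condition.symm,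
    Fork.IsLimit.lift_ι h, fun {_} hm => Fork.IsLimit.hom_ext h
      (hm.trans (Fork.IsLimit.lift_ι' h s.ι _).symm)⟩

/-- An equalizer precomposed with an isomorphism is an equalizer. -/
def forkPrecomp {X Y Z Z' : A} {f g : X ⟶ Y} {ι : Z ⟶ X} {w : ι ≫ f = ι ≫ g}
    (h : IsLimit (Fork.ofι ι w)) (e : Z' ≅ Z)
    (w' : (e.hom ≫ ι) ≫ f = (e.hom ≫ ι) ≫ g) : IsLimit (Fork.ofι (e.hom ≫ ι) w') :=
  IsLimit.ofIsoLimit h (Fork.ext (s := Fork.ofι (e.hom ≫ ι) w') (t := Fork.ofι ι w) e rfl).symm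

end Forks

open Functor.OplaxLeftLinear

variable {C : Type u} [Category.{v} C] [MonoidalCategory C]
variable {D : Type u₁} [Category.{v₁} D] [MonoidalLeftAction C D]

namespace LeftExactComonad

section Cofree

variable (K : LeftExactComonad C D)

/-- The comultiplication as a morphism of cofree comodules. -/
def cofreeComul (d : D) : K.cofree.obj d ⟶ K.cofree.obj (K.obj d) where
  f := K.δ.app d
  h := K.coassoc d

/-- The coaction as a morphism to the cofree comodule. -/
def coaction (A : K.EM) : A ⟶ K.cofree.obj A.A where
  f := A.a
  h := A.coassoc.symm

lemma coaction_naturality {A B : K.EM} (g : A ⟶ B) :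
    g ≫ K.coaction B = K.coaction A ≫ K.cofree.map g.f :=
  Comonad.Coalgebra.Hom.ext g.h.symm

lemma cofreeComul_naturality {d d' : D} (f : d ⟶ d') :
    K.cofree.map f ≫ K.cofreeComul d' = K.cofreeComul d ≫ K.cofree.map (K.map f) :=
  Comonad.Coalgebra.Hom.ext (K.δ.naturality f)

lemma cofreeComul_counit (d : D) : K.cofreeComul d ≫ K.cofree.map (K.ε.app d) = 𝟙 _ :=
  Comonad.Coalgebra.Hom.ext (K.right_counit d)

lemma cofreeComul_coassoc (d : D) : K.cofreeComul d ≫ K.cofree.map (K.δ.app d) =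
    K.cofreeComul d ≫ K.cofreeComul (K.obj d) :=
  Comonad.Coalgebra.Hom.ext (K.coassoc d)

lemma coaction_condition (A : K.EM) :
    K.coaction A ≫ K.cofree.map A.a = K.coaction A ≫ K.cofreeComul A.A :=
  Comonad.Coalgebra.Hom.ext A.coassoc.symm

/-- Every comodule is an equalizer of cofree comodules. -/
def coactionIsLimit (A : K.EM) :
    IsLimit (Fork.ofι (K.coaction A) (K.coaction_condition A)) :=
  Comonad.beckCoalgebraEqualizer A

variable [HasEqualizers D] [SeparatelyLeftExact C D] {K}

/-- Tested against `univ`, this is the compatibility of `δ` with the oplax structure, lifted from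
the base to comodules. -/
lemma δ_cofree_cofreeComul (c : C) (d : D) :
    δₗ K.cofree c d ≫ c ⊴ₗ K.cofreeComul d =
      K.cofreeComul (c ⊙ₗ d) ≫ K.cofree.map (K.str c d) ≫ δₗ K.cofree c (K.obj d) := by
  change _ ≫ K.lintonRight c (K.cofreeComul d) = _
  apply univ_ext
  simp only [Comonad.Coalgebra.comp_f, assoc]
  rw [lintonRight_univ, δ_cofree_univ, ← assoc, δ_cofree_univ]
  exact K.str_comul c d

/-- Tested against `univ`, this is multilinearity of `χ.f ≫ K.univ c A`. As an equation of comodule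
morphisms it can be transported along a functor on `K.EM`. -/
lemma comp_lintonRight_coaction {c : C} {A B : K.EM} (χ : B ⟶ K.linton c A) :
    χ ≫ K.lintonRight c (K.coaction A) =
      K.coaction B ≫ K.cofree.map (χ.f ≫ K.univ c A) ≫ δₗ K.cofree c A.A := by
  apply univ_ext
  have h := isMultilinear_univ.precomp χ
  simp only [Comonad.Coalgebra.comp_f, assoc]
  rw [lintonRight_univ, δ_cofree_univ, ← assoc]
  exact h.symm

end Cofree

end LeftExactComonad

open LeftExactComonad

/-! ### From equivalences of Eilenberg–Moore categories to Morita equivalences. -/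

section OfFunctor

variable [HasFiniteLimits D] [SeparatelyLeftExact C D]
variable {K K' : LeftExactComonad C D}

instance (K : LeftExactComonad C D) : PreservesFiniteLimits K.cofree :=
  have : PreservesLimitsOfSize.{0, 0} K.cofree := K.adj.rightAdjoint_preservesLimits
  inferInstance

section

variable (T : K.EM ⥤ K'.EM) [T.OplaxLeftLinear C]

/-- The comodule morphism `T (K (c ▷ d)) ⟶ c ▶ T (K d)`. -/
noncomputable def strOfFunctor (c : C) (d : D) :
    T.obj (K.cofree.obj (c ⊙ₗ d)) ⟶ K'.linton c (T.obj (K.cofree.obj d)) :=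
  T.map (δₗ K.cofree c d) ≫ δₗ T c (K.cofree.obj d)

lemma strOfFunctor_cofreeComul (c : C) (d : D) :
    strOfFunctor T c d ≫ K'.lintonRight c (T.map (K.cofreeComul d)) =
      T.map (K.cofreeComul (c ⊙ₗ d)) ≫ T.map (K.cofree.map (K.str c d)) ≫
        strOfFunctor T c (K.obj d) := by
  have h := δₗ_naturality_right T c (K.cofreeComul d)
  change (_ ≫ _) ≫ c ⊴ₗ T.map (K.cofreeComul d) = _ ≫ _ ≫ _ ≫ _
  rw [assoc]
  erw [← h]
  rw [← T.map_comp_assoc, δ_cofree_cofreeComul, T.map_comp, T.map_comp]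
  simp only [assoc]

lemma δ_cofree_comp (c : C) (d : D) : δₗ (K.cofree ⋙ T ⋙ K'.forget) c d =
    (strOfFunctor T c d).f ≫ K'.univ c (T.obj (K.cofree.obj d)) :=
  (assoc _ _ _).symm

/-- The bicoact functor given by a left exact oplax module functor between Eilenberg--Moore
categories. -/
noncomputable def Bicoact.ofFunctor [PreservesFiniteLimits T] : Bicoact K' K where
  functor := K.cofree ⋙ T ⋙ K'.forget
  lex := inferInstance
  oplax := inferInstance
  la :=
    { app d := (T.obj (K.cofree.obj d)).a
      naturality _ _ f := (T.map (K.cofree.map f)).h.symm }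
  ra :=
    { app d := (T.map (K.cofreeComul d)).f
      naturality _ _ f := congrArg Comonad.Coalgebra.Hom.f
        ((T.map_comp _ _).symm.trans ((congrArg T.map (K.cofreeComul_naturality f)).trans
          (T.map_comp _ _))) }
  la_mod c d := by
    -- Compatibility of the left coaction with the module structure is multilinearity of the
    -- structure morphism of the composite.
    have h := (isMultilinear_univ (K := K') (c := c)).precomp (strOfFunctor T c d)
    rw [δ_cofree_comp]
    refine h.symm.trans (congrArg (_ ≫ ·) (congrArg (· ≫ _) (congrArg K'.map ?_)))
    exact (δ_cofree_comp T c d).symm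
  ra_mod c d := by
    have h := congrArg (fun t => t.f ≫ K'.univ c _) (strOfFunctor_cofreeComul T c d)
    simp only [Comonad.Coalgebra.comp_f, assoc] at h
    rw [lintonRight_univ, ← δ_cofree_comp, ← assoc, ← δ_cofree_comp] at h
    exact h
  la_counit d := (T.obj (K.cofree.obj d)).counit
  la_coassoc d := (T.obj (K.cofree.obj d)).coassoc
  ra_counit d := congrArg Comonad.Coalgebra.Hom.f
    ((T.map_comp _ _).symm.trans ((congrArg T.map (K.cofreeComul_counit d)).trans (T.map_id _)))
  ra_coassoc d := congrArg Comonad.Coalgebra.Hom.f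
    ((T.map_comp _ _).symm.trans ((congrArg T.map (K.cofreeComul_coassoc d)).trans
      (T.map_comp _ _)))
  la_ra d := (T.map (K.cofreeComul d)).h

end

section Cotensor

variable (T : K.EM ⥤ K'.EM) [T.OplaxLeftLinear C] (S : K'.EM ⥤ K.EM) [S.OplaxLeftLinear C]
  (η : 𝟭 K'.EM ≅ S ⋙ T)

/-- The natural morphism `X ⟶ T (K (S X))`. -/
def cotensorUnit (X : K'.EM) : X ⟶ T.obj (K.cofree.obj (S.obj X).A) :=
  η.hom.app X ≫ T.map (K.coaction (S.obj X))

lemma cotensorUnit_naturality {X Y : K'.EM} (g : X ⟶ Y) :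
    g ≫ cotensorUnit T S η Y = cotensorUnit T S η X ≫ T.map (K.cofree.map (S.map g).f) := by
  have h : g ≫ η.hom.app Y = η.hom.app X ≫ T.map (S.map g) := η.hom.naturality g
  rw [cotensorUnit, cotensorUnit, reassoc_of% h, assoc, ← T.map_comp, ← T.map_comp,
    coaction_naturality]

/-- The compatibility of `cotensorUnit` with the module structures before passing to underlying
objects: `hη` handles `η`, and `comp_lintonRight_coaction` handles the coaction. -/
lemma cotensorUnit_str (hη : IsModuleTransformation C (F := 𝟭 K'.EM) (G := S ⋙ T) η.hom)
    (c : C) (d : D) :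
    δₗ K'.cofree c d ≫ K'.lintonRight c (cotensorUnit T S η (K'.cofree.obj d)) =
      cotensorUnit T S η (K'.cofree.obj (c ⊙ₗ d)) ≫
        T.map (K.cofree.map ((strOfFunctor S c d).f ≫ K.univ c (S.obj (K'.cofree.obj d)))) ≫
          strOfFunctor T c (S.obj (K'.cofree.obj d)).A := by
  have h1 : c ⊴ₗ η.hom.app (K'.cofree.obj d) = η.hom.app (c ⊙ₗ K'.cofree.obj d) ≫
      T.map (δₗ S c (K'.cofree.obj d)) ≫ δₗ T c (S.obj (K'.cofree.obj d)) :=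
    (id_comp _).symm.trans (hη c (K'.cofree.obj d))
  have h2 : δₗ K'.cofree c d ≫ η.hom.app (c ⊙ₗ K'.cofree.obj d) =
      η.hom.app (K'.cofree.obj (c ⊙ₗ d)) ≫ T.map (S.map (δₗ K'.cofree c d)) :=
    η.hom.naturality _
  have h3 := δₗ_naturality_right T c (K.coaction (S.obj (K'.cofree.obj d)))
  have h4 : strOfFunctor S c d ≫ c ⊴ₗ K.coaction (S.obj (K'.cofree.obj d)) = _ :=
    comp_lintonRight_coaction (strOfFunctor S c d)
  change δₗ K'.cofree c d ≫ c ⊴ₗ (η.hom.app (K'.cofree.obj d) ≫ T.map (K.coaction _)) = _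
  rw [actionHomRight_comp, h1, assoc, assoc, ← h3, reassoc_of% h2, cotensorUnit, assoc]
  have h5 := congrArg (fun t => T.map t ≫ δₗ T c (K.cofree.obj (S.obj (K'.cofree.obj d)).A)) h4
  simp only [T.map_comp, assoc] at h5
  have h6 : strOfFunctor T c (S.obj (K'.cofree.obj d)).A = T.map (δₗ K.cofree c _) ≫ δₗ T c _ := rfl
  have h7 : strOfFunctor S c d = S.map (δₗ K'.cofree c d) ≫ δₗ S c (K'.cofree.obj d) := rfl
  rw [h6, ← h5, h7, T.map_comp, assoc]

/-- The left exact composite of `T` and the forgetful functor preserves the presentation of `S (K'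
d)` as an equalizer of cofree comodules. The result is the cotensor fork, with vertex identified
with `K' d` through `η`. -/
lemma isCotensor_ofFunctor [PreservesFiniteLimits T] [PreservesFiniteLimits S]
    (hη : IsModuleTransformation C (F := 𝟭 K'.EM) (G := S ⋙ T) η.hom) :
    IsCotensor (Bicoact.ofFunctor T) (Bicoact.ofFunctor S) (Bicoact.regular K') := by
  refine ⟨{ app d := (cotensorUnit T S η (K'.cofree.obj d)).f
            naturality d d' f := ?_ }, ?_, ?_, ?_, ?_⟩
  · exact congrArg Comonad.Coalgebra.Hom.f (cotensorUnit_naturality T S η (K'.cofree.map f))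
  · intro c d
    have h := congrArg (fun t => t.f ≫ K'.univ c _) (cotensorUnit_str T S η hη c d)
    simp only [Comonad.Coalgebra.comp_f, assoc] at h
    rw [lintonRight_univ, ← assoc, δ_cofree_univ] at h
    exact h.trans (congrArg (_ ≫ ·) (congrArg₂ (fun a b => (T.map (K.cofree.map a)).f ≫ b)
      (δ_cofree_comp S c d).symm (δ_cofree_comp T c _).symm))
  · intro d
    exact (cotensorUnit T S η (K'.cofree.obj d)).h.symm
  · intro d
    exact congrArg Comonad.Coalgebra.Hom.f
      (cotensorUnit_naturality T S η (K'.cofreeComul d)).symm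
  · intro d
    let A := S.obj (K'.cofree.obj d)
    -- The cofree presentation lists the map induced by the coaction first, whereas the cotensor
    -- product lists the right coaction first.
    have h := forkSwap (isLimitForkMapOfIsLimit (T ⋙ K'.forget) _ (K.coactionIsLimit A))
    have w' := congrArg (fun t => (η.hom.app (K'.cofree.obj d) ≫ T.map t).f)
      (K.coaction_condition A).symm
    simp only [T.map_comp, Comonad.Coalgebra.comp_f] at w'
    simp only [← assoc] at w'
    exact ⟨w', ⟨forkPrecomp h (K'.forget.mapIso (η.app (K'.cofree.obj d))) w'⟩⟩

end Cotensor

lemma isModuleTransformation_inv {E : Type u₂} [Category.{v₂} E] [MonoidalLeftAction C E]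
    {F G : D ⥤ E} [F.OplaxLeftLinear C] [G.OplaxLeftLinear C] (e : F ≅ G)
    (h : IsModuleTransformation C e.hom) : IsModuleTransformation C e.inv := by
  intro c d
  have h' := h c d
  rw [← cancel_epi (e.hom.app (c ⊙ₗ d)), ← reassoc_of% h', ← actionHomRight_comp]
  simp

/-- Comonads with equivalent Eilenberg--Moore module categories are Morita equivalent. -/
lemma Morita.of_modEquiv (h : ModEquiv C K.EM K'.EM) : Morita K K' := by
  obtain ⟨T, hT, ⟨_⟩⟩ := h
  let adj : T.inv ⊣ T := T.asEquivalence.symm.toAdjunction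
  let : T.inv.OplaxLeftLinear C := oplaxOfAdj adj
  let η : 𝟭 K'.EM ≅ T.inv ⋙ T := asIso adj.unit
  let κ : T ⋙ T.inv ≅ 𝟭 K.EM := asIso adj.counit
  -- `Bicoact.ofFunctor` reverses the order of the comonads, so the `K`-`K'`-bicoact functor comes
  -- from `T.inv`.
  refine ⟨Bicoact.ofFunctor T.inv, Bicoact.ofFunctor T, ?_, ?_⟩
  · exact isCotensor_ofFunctor T.inv T κ.symm
      (isModuleTransformation_inv κ (counit_isModuleTransformation adj))
  · exact isCotensor_ofFunctor T T.inv η (unit_isModuleTransformation adj)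

end OfFunctor

end ModCat

/-! ### The cotensor product of a bicoact functor with comodules. -/

namespace ModCat

open Functor.OplaxLeftLinear LeftExactComonad

variable {C : Type u} [Category.{v} C] [MonoidalCategory C]
variable {D : Type u₁} [Category.{v₁} D] [MonoidalLeftAction C D]

namespace Bicoact

attribute [instance] Bicoact.lex

section Basic

variable {K K' : LeftExactComonad C D} (F : Bicoact K K')

/-- The component `F d ⟶ K (F d)` of the left coaction. -/
def left (d : D) : F.functor.obj d ⟶ K.obj (F.functor.obj d) := F.la.app d

/-- The component `F d ⟶ F (K' d)` of the right coaction. -/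
def right (d : D) : F.functor.obj d ⟶ F.functor.obj (K'.obj d) := F.ra.app d

lemma left_naturality {d d' : D} (f : d ⟶ d') :
    F.functor.map f ≫ F.left d' = F.left d ≫ K.map (F.functor.map f) :=
  F.la.naturality f

lemma right_naturality {d d' : D} (f : d ⟶ d') :
    F.functor.map f ≫ F.right d' = F.right d ≫ F.functor.map (K'.map f) :=
  F.ra.naturality f

lemma δ_left (c : C) (d : D) : δₗ F.functor c d ≫ c ⊴ₗ F.left d =
    F.left (c ⊙ₗ d) ≫ K.map (δₗ F.functor c d) ≫ K.str c (F.functor.obj d) :=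
  F.la_mod c d

lemma δ_right (c : C) (d : D) : δₗ F.functor c d ≫ c ⊴ₗ F.right d =
    F.right (c ⊙ₗ d) ≫ F.functor.map (K'.str c d) ≫ δₗ F.functor c (K'.obj d) :=
  F.ra_mod c d

lemma left_right (d : D) : F.left d ≫ K.map (F.right d) = F.right d ≫ F.left (K'.obj d) :=
  F.la_ra d

end Basic

section Cotensor

variable {K K' : LeftExactComonad C D} (F : Bicoact K K') [HasEqualizers D]

/-- The object underlying the cotensor product of a bicoact functor and a comodule. -/
noncomputable def cotObj (A : K'.EM) : D :=
  equalizer (F.right A.A) (F.functor.map A.a)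

/-- The inclusion of the cotensor product `F □ A ⟶ F A`. -/
noncomputable def cotι (A : K'.EM) : F.cotObj A ⟶ F.functor.obj A.A := equalizer.ι _ _

instance (A : K'.EM) : Mono (F.cotι A) := inferInstanceAs (Mono (equalizer.ι _ _))

lemma cotι_condition (A : K'.EM) :
    F.cotι A ≫ F.right A.A = F.cotι A ≫ F.functor.map A.a :=
  equalizer.condition _ _

/-- The left exact functor `H` is left free so that one factorization serves the identity, the
comonad, another bicoact functor and `c ⊙ₗ -`. -/
lemma exists_cot_lift (H : D ⥤ D) [PreservesFiniteLimits H] (A : K'.EM) {X : D}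
    (f : X ⟶ H.obj (F.functor.obj A.A))
    (h : f ≫ H.map (F.right A.A) = f ≫ H.map (F.functor.map A.a)) :
    ∃ g : X ⟶ H.obj (F.cotObj A), g ≫ H.map (F.cotι A) = f := by
  have hl := isLimitForkMapOfIsLimit H (F.cotι_condition A) (equalizerIsEqualizer _ _)
  exact ⟨Fork.IsLimit.lift hl f h, Fork.IsLimit.lift_ι hl⟩

/-- The left coaction of `F` restricts to the equalizer because it commutes with the right coaction.
-/
lemma exists_cotCoact (A : K'.EM) : ∃ g : F.cotObj A ⟶ K.obj (F.cotObj A),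
    g ≫ K.map (F.cotι A) = F.cotι A ≫ F.left A.A :=
  F.exists_cot_lift K.toFunctor A (F.cotι A ≫ F.left A.A) (by
    rw [assoc, assoc, F.left_right, reassoc_of% F.cotι_condition A, ← F.left_naturality])

/-- The coaction on the cotensor product. -/
noncomputable def cotCoact (A : K'.EM) : F.cotObj A ⟶ K.obj (F.cotObj A) :=
  (F.exists_cotCoact A).choose

lemma cotCoact_ι (A : K'.EM) : F.cotCoact A ≫ K.map (F.cotι A) = F.cotι A ≫ F.left A.A :=
  (F.exists_cotCoact A).choose_spec

lemma left_counit (d : D) : F.left d ≫ K.ε.app (F.functor.obj d) = 𝟙 _ := F.la_counit d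

lemma left_coassoc (d : D) :
    F.left d ≫ K.δ.app (F.functor.obj d) = F.left d ≫ K.map (F.left d) := F.la_coassoc d

/-- The cotensor product of a bicoact functor and a comodule. -/
noncomputable abbrev cotComodule (A : K'.EM) : K.EM where
  A := F.cotObj A
  a := F.cotCoact A
  counit := by
    rw [← cancel_mono (F.cotι A), assoc, ← Comonad.counit_naturality,
      reassoc_of% F.cotCoact_ι A, F.left_counit]
    simp
  coassoc := by
    rw [← cancel_mono (K.map (K.map (F.cotι A))), assoc, assoc,
      ← Comonad.delta_naturality, reassoc_of% F.cotCoact_ι A, ← Functor.map_comp,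
      F.cotCoact_ι A, Functor.map_comp, reassoc_of% F.cotCoact_ι A, F.left_coassoc]

lemma exists_cotMap {A A' : K'.EM} (g : A ⟶ A') : ∃ k : F.cotComodule A ⟶ F.cotComodule A',
    k.f ≫ F.cotι A' = F.cotι A ≫ F.functor.map g.f := by
  obtain ⟨k, hk⟩ : ∃ k : F.cotObj A ⟶ F.cotObj A', k ≫ F.cotι A' = _ :=
    F.exists_cot_lift (𝟭 D) A' (F.cotι A ≫ F.functor.map g.f) (by
      dsimp
      rw [assoc, assoc, F.right_naturality, reassoc_of% F.cotι_condition A, ← Functor.map_comp,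
        ← Functor.map_comp, g.h])
  refine ⟨⟨k, ?_⟩, hk⟩
  rw [← cancel_mono (K.map (F.cotι A')), assoc, assoc, ← Functor.map_comp, hk, F.cotCoact_ι,
    reassoc_of% hk, F.left_naturality, Functor.map_comp, reassoc_of% F.cotCoact_ι A]

/-- The cotensor product with a bicoact functor, on morphisms. -/
noncomputable def cotMap {A A' : K'.EM} (g : A ⟶ A') : F.cotComodule A ⟶ F.cotComodule A' :=
  (F.exists_cotMap g).choose

lemma cotMap_ι {A A' : K'.EM} (g : A ⟶ A') :
    (F.cotMap g).f ≫ F.cotι A' = F.cotι A ≫ F.functor.map g.f :=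
  (F.exists_cotMap g).choose_spec

/-- The cotensor product with a bicoact functor. -/
noncomputable abbrev cot : K'.EM ⥤ K.EM where
  obj A := F.cotComodule A
  map g := F.cotMap g
  map_id A := by
    ext
    rw [← cancel_mono (F.cotι A), F.cotMap_ι]
    simp
  map_comp {A A' A''} g g' := by
    ext
    rw [← cancel_mono (F.cotι A''), F.cotMap_ι, Comonad.Coalgebra.comp_f,
      Comonad.Coalgebra.comp_f, assoc, F.cotMap_ι, reassoc_of% F.cotMap_ι g, Functor.map_comp]

variable [SeparatelyLeftExact C D]

section Multilinear

variable {F} {c : C} {A B : K'.EM}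

/-- `F.functor.map f` followed by the structure morphism restricts to the equalizers: the right
coaction of `F` is a module transformation, and multilinearity moves the coaction of `B` to that of
`A`. -/
lemma exists_cotMult (f : B.A ⟶ c ⊙ₗ A.A) (hf : K'.IsMultilinear c f) :
    ∃ k : F.cotObj B ⟶ c ⊙ₗ F.cotObj A,
      k ≫ c ⊴ₗ F.cotι A = F.cotι B ≫ F.functor.map f ≫ δₗ F.functor c A.A := by
  have hf' : B.a ≫ K'.map f ≫ K'.str c A.A = f ≫ c ⊴ₗ A.a := hf
  have h := δₗ_naturality_right F.functor c A.a
  have h' : (F.cotι B ≫ F.functor.map f ≫ δₗ F.functor c A.A) ≫ c ⊴ₗ F.right A.A =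
      (F.cotι B ≫ F.functor.map f ≫ δₗ F.functor c A.A) ≫ c ⊴ₗ F.functor.map A.a := by
    simp only [assoc]
    rw [← h, F.δ_right, ← assoc (F.functor.map f), F.right_naturality, assoc,
      reassoc_of% F.cotι_condition B, ← Functor.map_comp_assoc, ← Functor.map_comp_assoc,
      ← Functor.map_comp_assoc, assoc, hf']
  exact F.exists_cot_lift (actionLeft D c) A _ h'

/-- The cotensor product with a bicoact functor, on multilinear morphisms. -/
noncomputable def cotMult (F : Bicoact K K') (f : B.A ⟶ c ⊙ₗ A.A) (hf : K'.IsMultilinear c f) :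
    F.cotObj B ⟶ c ⊙ₗ F.cotObj A :=
  (exists_cotMult f hf).choose

lemma cotMult_ι (f : B.A ⟶ c ⊙ₗ A.A) (hf : K'.IsMultilinear c f) :
    F.cotMult f hf ≫ c ⊴ₗ F.cotι A = F.cotι B ≫ F.functor.map f ≫ δₗ F.functor c A.A :=
  (exists_cotMult f hf).choose_spec

lemma cotMult_ι_assoc (f : B.A ⟶ c ⊙ₗ A.A) (hf : K'.IsMultilinear c f) {Z : D}
    (h : c ⊙ₗ F.functor.obj A.A ⟶ Z) :
    F.cotMult f hf ≫ c ⊴ₗ F.cotι A ≫ h =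
      F.cotι B ≫ F.functor.map f ≫ δₗ F.functor c A.A ≫ h := by
  rw [← assoc, cotMult_ι, assoc, assoc]

/-- This reduces to the left coaction of `F` being a module transformation. -/
lemma isMultilinear_cotMult (f : B.A ⟶ c ⊙ₗ A.A) (hf : K'.IsMultilinear c f) :
    K.IsMultilinear c (B := F.cotComodule B) (A := F.cotComodule A) (F.cotMult f hf) := by
  have h := δₗ_naturality_right K.toFunctor c (F.cotι A)
  dsimp only [IsMultilinear, str] at h ⊢
  rw [← cancel_mono (c ⊴ₗ K.map (F.cotι A))]
  simp only [assoc]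
  rw [← h, ← Functor.map_comp_assoc, cotMult_ι, ← actionHomRight_comp, F.cotCoact_ι,
    actionHomRight_comp, cotMult_ι_assoc, Functor.map_comp, assoc, reassoc_of% F.cotCoact_ι B,
    F.δ_left, ← assoc (F.functor.map f), F.left_naturality, Functor.map_comp]
  simp only [assoc, str]

lemma cotMap_cotMult {B' : K'.EM} (g : B' ⟶ B) (f : B.A ⟶ c ⊙ₗ A.A)
    (hf : K'.IsMultilinear c f) :
    (F.cotMap g).f ≫ F.cotMult f hf = F.cotMult (g.f ≫ f) (hf.precomp g) := by
  rw [← cancel_mono (c ⊴ₗ F.cotι A), assoc, cotMult_ι, cotMult_ι, reassoc_of% F.cotMap_ι g,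
    Functor.map_comp, assoc]

end Multilinear

/-- The multilinear morphisms `F □ (c ▶ A) ⟶ c ▷ (F □ A)`. -/
noncomputable def cotStructure : K.MultilinearStructure F.cot where
  str c A := F.cotMult (K'.univ c A) isMultilinear_univ
  multilinear c A := isMultilinear_cotMult _ _
  naturality_left {c c'} f A := by
    have h1 := δₗ_naturality_left F.functor f A.A
    have h2 := lintonLeft_univ f A
    change (F.cotMap (K'.lintonLeft f A)).f ≫ _ = _ ≫ f ⊵ₗ F.cotObj A
    rw [cotMap_cotMult, ← cancel_mono (c' ⊴ₗ F.cotι A), cotMult_ι, assoc, ← action_exchange,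
      cotMult_ι_assoc, ← h1, h2, Functor.map_comp, assoc]
    rfl
  naturality_right c A A' g := by
    have h1 := δₗ_naturality_right F.functor c g.f
    have h2 := lintonRight_univ c g
    change (F.cotMap (K'.lintonRight c g)).f ≫ _ = _ ≫ c ⊴ₗ (F.cotMap g).f
    rw [cotMap_cotMult, ← cancel_mono (c ⊴ₗ F.cotι A'), cotMult_ι, assoc, ← actionHomRight_comp,
      F.cotMap_ι, actionHomRight_comp, cotMult_ι_assoc, ← h1, h2, Functor.map_comp, assoc]
    rfl
  associativity c c' A := by
    have h1 := δₗ_associativity F.functor c c' A.A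
    have h2 := lintonAssoc_inv_univ c c' A
    have h3 := δₗ_naturality_right F.functor c (K'.univ c' A)
    have h4 : K'.univ (c ⊗ c') A ≫ (αₗ c c' A.A).hom = (K'.lintonAssoc c c' A).hom.f ≫
        K'.univ c (K'.linton c' A) ≫ c ⊴ₗ K'.univ c' A := by
      rw [← Iso.eq_comp_inv, assoc, assoc, ← h2, ← assoc, ← Comonad.Coalgebra.comp_f]
      simp
    change _ ≫ (αₗ c c' (F.cotObj A)).hom = (F.cotMap (K'.lintonAssoc c c' A).hom).f ≫
      F.cotMult (K'.univ c (K'.linton c' A)) _ ≫ c ⊴ₗ F.cotMult (K'.univ c' A) _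
    have : Mono (c ⊴ₗ c' ⊴ₗ F.cotι A) := inferInstance
    rw [← cancel_mono (c ⊴ₗ c' ⊴ₗ F.cotι A)]
    have h5 : (αₗ c c' (F.cotObj A)).hom ≫ c ⊴ₗ c' ⊴ₗ F.cotι A =
        (c ⊗ c') ⊴ₗ F.cotι A ≫ (αₗ c c' (F.functor.obj A.A)).hom := by simp
    simp only [assoc]
    rw [h5, cotMult_ι_assoc, h1, ← actionHomRight_comp, cotMult_ι]
    simp only [actionHomRight_comp]
    rw [cotMult_ι_assoc, reassoc_of% F.cotMap_ι (K'.lintonAssoc c c' A).hom,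
      ← Functor.map_comp_assoc, h4, ← reassoc_of% h3]
    simp only [Functor.map_comp, assoc]
    rfl
  unitality A := by
    have h1 := δₗ_unitality_inv (C := C) F.functor A.A
    have h2 := lintonUnit_inv_univ A
    have h3 := actionUnitIso_inv_naturality (C := C) (F.cotι A)
    change (λₗ (F.cotObj A)).inv = (F.cotMap (K'.lintonUnit A).inv).f ≫ _
    rw [cotMap_cotMult, ← cancel_mono ((𝟙_ C) ⊴ₗ F.cotι A), cotMult_ι, h3, h1, h2]

end Cotensor

end Bicoact

end ModCat

/-! ### Invertible bicoact functors give equivalences of module categories. -/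

namespace ModCat

open Functor.OplaxLeftLinear LeftExactComonad

variable {C : Type u} [Category.{v} C] [MonoidalCategory C]
variable {D : Type u₁} [Category.{v₁} D] [MonoidalLeftAction C D]

namespace Bicoact

variable {K K' : LeftExactComonad C D}

/-- A morphism exhibiting the regular bicoact functor as a cotensor product, in components. -/
structure RegularCotensor (F : Bicoact K K') (G : Bicoact K' K) where
  /-- the components of the morphism to the composite -/
  j (d : D) : K.obj d ⟶ F.functor.obj (G.functor.obj d)
  naturality {d d' : D} (f : d ⟶ d') :
    K.map f ≫ j d' = j d ≫ F.functor.map (G.functor.map f)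
  mod (c : C) (d : D) : K.str c d ≫ c ⊴ₗ j d =
    j (c ⊙ₗ d) ≫ F.functor.map (δₗ G.functor c d) ≫ δₗ F.functor c (G.functor.obj d)
  left (d : D) : j d ≫ F.left (G.functor.obj d) = K.δ.app d ≫ K.map (j d)
  right (d : D) : j d ≫ F.functor.map (G.right d) = K.δ.app d ≫ j (K.obj d)
  condition (d : D) : j d ≫ F.right (G.functor.obj d) = j d ≫ F.functor.map (G.left d)
  isLimit (d : D) : IsLimit (Fork.ofι (j d) (condition d))

lemma nonempty_regularCotensor {F : Bicoact K K'} {G : Bicoact K' K}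
    (h : IsCotensor F G (regular K)) : Nonempty (RegularCotensor F G) := by
  obtain ⟨j, h1, h2, h3, h4⟩ := h
  exact ⟨⟨fun d => j.app d, fun f => j.naturality f, h1, h2, h3, fun d => (h4 d).choose,
    fun d => (h4 d).choose_spec.some⟩⟩

namespace RegularCotensor

variable {F : Bicoact K K'} {G : Bicoact K' K} (J : RegularCotensor F G)

lemma mono_j (d : D) : Mono (J.j d) := mono_of_isLimit_fork (J.isLimit d)

lemma exists_lift_j {d X : D} (f : X ⟶ F.functor.obj (G.functor.obj d))
    (h : f ≫ F.right (G.functor.obj d) = f ≫ F.functor.map (G.left d)) :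
    ∃ g : X ⟶ K.obj d, g ≫ J.j d = f :=
  ⟨Fork.IsLimit.lift (J.isLimit d) f h, Fork.IsLimit.lift_ι (J.isLimit d)⟩

variable [HasEqualizers D]

/-- The map `A ⟶ K A ⟶ F (G A)` factors first through `F (G □ A)`, by compatibility of `j` with the
right coactions, and then through `F □ (G □ A)`, by the fork condition on `j`. -/
lemma exists_unit (A : K.EM) : ∃ t : A ⟶ F.cotComodule (G.cotComodule A),
    t.f ≫ F.cotι (G.cotComodule A) ≫ F.functor.map (G.cotι A) = A.a ≫ J.j A.A := by
  obtain ⟨t, ht⟩ := G.exists_cot_lift F.functor A (A.a ≫ J.j A.A) (by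
    rw [assoc, assoc, J.right, ← J.naturality, ← assoc, A.coassoc, assoc])
  obtain ⟨s, hs⟩ : ∃ s : A.A ⟶ F.cotObj (G.cotComodule A), s ≫ F.cotι (G.cotComodule A) = t :=
    F.exists_cot_lift (𝟭 D) (G.cotComodule A) t (by
      change t ≫ F.right (G.cotObj A) = t ≫ F.functor.map (G.cotCoact A)
      rw [← cancel_mono (F.functor.map (K'.map (G.cotι A))), assoc, assoc, ← F.right_naturality,
        ← Functor.map_comp, G.cotCoact_ι, Functor.map_comp, reassoc_of% ht, reassoc_of% ht,
        J.condition])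
  have hst : s ≫ F.cotι (G.cotComodule A) ≫ F.functor.map (G.cotι A) = A.a ≫ J.j A.A := by
    rw [← assoc, hs, ht]
  refine ⟨⟨s, ?_⟩, hst⟩
  change A.a ≫ K.map s = s ≫ F.cotCoact (G.cotComodule A)
  rw [← cancel_mono (K.map (F.cotι (G.cotComodule A))),
    ← cancel_mono (K.map (F.functor.map (G.cotι A)))]
  simp only [assoc]
  rw [reassoc_of% F.cotCoact_ι (G.cotComodule A), ← Functor.map_comp, ← Functor.map_comp, hst,
    ← F.left_naturality, reassoc_of% hst, J.left, Functor.map_comp, ← reassoc_of% A.coassoc]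

/-- The comodule morphism `A ⟶ F □ (G □ A)` -/
noncomputable def unit (A : K.EM) : A ⟶ F.cotComodule (G.cotComodule A) :=
  (J.exists_unit A).choose

lemma unit_ι (A : K.EM) :
    (J.unit A).f ≫ F.cotι (G.cotComodule A) ≫ F.functor.map (G.cotι A) = A.a ≫ J.j A.A :=
  (J.exists_unit A).choose_spec

/-- This is `F □ (G □ A) ≅ (F □ G) □ A ≅ K □ A ≅ A` on elements. The inclusion into `F (G A)`
factors through `j` as a map `y` to `K A`; since `y` equalizes `K.map A.a` and `δ`, it equals `y ≫ ε
≫ A.a`, and `y ≫ ε` is the inverse. -/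
lemma isIso_unit_f (A : K.EM) : IsIso (J.unit A).f := by
  have := J.mono_j A.A
  have := J.mono_j (K.obj A.A)
  obtain ⟨y, hy⟩ := J.exists_lift_j (F.cotι (G.cotComodule A) ≫ F.functor.map (G.cotι A)) (by
    rw [assoc, F.right_naturality, reassoc_of% F.cotι_condition (G.cotComodule A),
      ← Functor.map_comp, G.cotCoact_ι, Functor.map_comp, assoc])
  have h1 : y ≫ K.map A.a = y ≫ K.δ.app A.A := by
    rw [← cancel_mono (J.j (K.obj A.A)), assoc, assoc, J.naturality, ← J.right, reassoc_of% hy,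
      reassoc_of% hy, ← Functor.map_comp, ← Functor.map_comp, G.cotι_condition]
  have h2 : (y ≫ K.ε.app A.A) ≫ A.a = y := by
    rw [assoc, ← Comonad.counit_naturality, reassoc_of% h1, K.toComonad.left_counit, comp_id]
  refine ⟨y ≫ K.ε.app A.A, ?_, ?_⟩
  · have h3 : (J.unit A).f ≫ y = A.a := by
      rw [← cancel_mono (J.j A.A), assoc, hy, J.unit_ι]
    rw [reassoc_of% h3, A.counit]
  · rw [← cancel_mono (F.cotι (G.cotComodule A)), ← cancel_mono (F.functor.map (G.cotι A))]
    simp only [assoc, id_comp]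
    rw [J.unit_ι, reassoc_of% h2, hy]

lemma unit_naturality {A A' : K.EM} (f : A ⟶ A') :
    f ≫ J.unit A' = J.unit A ≫ F.cotMap (G.cotMap f) := by
  ext
  rw [Comonad.Coalgebra.comp_f, Comonad.Coalgebra.comp_f,
    ← cancel_mono (F.cotι (G.cotComodule A')), ← cancel_mono (F.functor.map (G.cotι A'))]
  simp only [assoc]
  rw [J.unit_ι, reassoc_of% F.cotMap_ι (G.cotMap f), ← Functor.map_comp, G.cotMap_ι,
    Functor.map_comp, reassoc_of% J.unit_ι A, ← J.naturality, f.h_assoc]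

/-- The natural isomorphism `A ≅ F □ (G □ A)`. -/
noncomputable def unitIso : 𝟭 K.EM ≅ G.cot ⋙ F.cot :=
  NatIso.ofComponents (fun A =>
    haveI : IsIso (K.forget.map (J.unit A)) := J.isIso_unit_f A
    haveI : IsIso (J.unit A) := isIso_of_reflects_iso (J.unit A) K.forget
    asIso (J.unit A)) (fun f => J.unit_naturality f)

variable [SeparatelyLeftExact C D]

/-- Naturality of the unit for multilinear morphisms; the essential input is that `j` is a module
transformation. -/
lemma comp_unit {c : C} {A B : K.EM} (f : B.A ⟶ c ⊙ₗ A.A) (hf : K.IsMultilinear c f) :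
    f ≫ c ⊴ₗ (J.unit A).f =
      (J.unit B).f ≫ F.cotMult (G.cotMult f hf) (isMultilinear_cotMult f hf) := by
  have hf' : B.a ≫ K.map f ≫ K.str c A.A = f ≫ c ⊴ₗ A.a := hf
  have h1 := δₗ_naturality_right F.functor c (G.cotι A)
  have h2 := cotMult_ι_assoc (F := F) (A := G.cotComodule A) (B := G.cotComodule B)
    (G.cotMult f hf) (isMultilinear_cotMult f hf)
    (c ⊴ₗ F.functor.map (G.cotι A))
  rw [← cancel_mono (c ⊴ₗ F.cotι (G.cotComodule A)),
    ← cancel_mono (c ⊴ₗ F.functor.map (G.cotι A))]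
  simp only [assoc]
  rw [h2, ← h1, ← Functor.map_comp_assoc, cotMult_ι, ← actionHomRight_comp,
    ← actionHomRight_comp, J.unit_ι, actionHomRight_comp, ← reassoc_of% hf', J.mod]
  simp only [Functor.map_comp, assoc]
  rw [reassoc_of% J.unit_ι B, ← reassoc_of% J.naturality f]

lemma cotMult_injective (J : RegularCotensor F G) {c : C} {A B : K.EM} {f f' : B.A ⟶ c ⊙ₗ A.A}
    (hf : K.IsMultilinear c f) (hf' : K.IsMultilinear c f') (h : G.cotMult f hf = G.cotMult f' hf') :
    f = f' := by
  have := J.isIso_unit_f A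
  rw [← cancel_mono (c ⊴ₗ (J.unit A).f), J.comp_unit f hf, J.comp_unit f' hf']
  simp only [h]

/-- The preimage is `G.cotMult f hf` conjugated by the unit isomorphisms of `J'`. Its image under
`F.cotMult` is `f` because both agree after `G.cotMult`, which `J` makes injective. -/
lemma exists_cotMult_eq (J : RegularCotensor F G) (J' : RegularCotensor G F) {c : C} {A B : K'.EM}
    (f : F.cotObj B ⟶ c ⊙ₗ F.cotObj A)
    (hf : K.IsMultilinear c (B := F.cotComodule B) (A := F.cotComodule A) f) :
    ∃ (g : B.A ⟶ c ⊙ₗ A.A) (hg : K'.IsMultilinear c g), F.cotMult g hg = f := by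
  have h1 : (J'.unitIso.inv.app A).f ≫ (J'.unit A).f = 𝟙 _ :=
    congrArg Comonad.Coalgebra.Hom.f (J'.unitIso.inv_hom_id_app A)
  have h2 : (J'.unitIso.inv.app B).f ≫ (J'.unit B).f = 𝟙 _ :=
    congrArg Comonad.Coalgebra.Hom.f (J'.unitIso.inv_hom_id_app B)
  have hg := ((isMultilinear_cotMult (F := G) f hf).precomp (J'.unit B)).postcomp
    (J'.unitIso.inv.app A)
  refine ⟨_, hg, ?_⟩
  have h3 := J'.comp_unit _ hg
  refine J.cotMult_injective (A := F.cotComodule A) (B := F.cotComodule B)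
    (isMultilinear_cotMult _ hg) hf ?_
  have := J'.isIso_unit_f B
  rw [← cancel_epi (J'.unit B).f, ← h3, assoc, ← actionHomRight_comp]
  refine (congrArg (fun t => _ ≫ c ⊴ₗ t) h1).trans ?_
  simp

/-- The cotensor product with an invertible bicoact functor is an equivalence of module
categories. -/
lemma modEquiv (J : RegularCotensor F G) (J' : RegularCotensor G F) : ModEquiv C K'.EM K.EM := by
  have hF : F.cot.IsEquivalence :=
    (CategoryTheory.Equivalence.mk F.cot G.cot J'.unitIso J.unitIso.symm).isEquivalence_functor
  let : F.cot.OplaxLeftLinear C := F.cotStructure.oplax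
  have (c : C) (A : K'.EM) : IsIso (δₗ F.cot c A) := by
    refine F.cotStructure.isIso_lift ?_ ?_ c A
    · intro c B A f hf
      obtain ⟨g, hg, rfl⟩ := J.exists_cotMult_eq J' f hf
      refine ⟨LeftExactComonad.lift g hg, ?_⟩
      refine (cotMap_cotMult _ _ isMultilinear_univ).trans ?_
      congr 1
      exact LeftExactComonad.lift_univ g hg
    · intro c B A g g' h
      refine univ_ext (J'.cotMult_injective (isMultilinear_univ.precomp g)
        (isMultilinear_univ.precomp g') ?_)
      exact (cotMap_cotMult _ _ isMultilinear_univ).symm.trans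
        (h.trans (cotMap_cotMult _ _ isMultilinear_univ))
  exact ⟨F.cot, hF, ⟨leftLinearOfIsIso F.cot⟩⟩

end RegularCotensor

end Bicoact

variable [HasFiniteLimits D] [SeparatelyLeftExact C D]

/-- Left exact oplax module comonads are Morita equivalent if and only if their Eilenberg--Moore
module categories are equivalent. -/
lemma morita_iff_modEquiv (K K' : LeftExactComonad C D) : Morita K K' ↔ ModEquiv C K.EM K'.EM := by
  refine ⟨fun ⟨F, G, h, h'⟩ => ?_, Morita.of_modEquiv⟩
  obtain ⟨J⟩ := Bicoact.nonempty_regularCotensor h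
  obtain ⟨J'⟩ := Bicoact.nonempty_regularCotensor h'
  exact (J.modEquiv J').symm

end ModCat

namespace ModCat

/-! ### The bijection between pairs and comonads. -/

section Correspondence

variable {C : Type u} [Category.{v} C] [Abelian C] [MonoidalCategory C] [EnoughInjectives C]
  [SeparatelyLeftExact C C]

lemma ReconstructionPair.equivalent_equivalence :
    Equivalence (ReconstructionPair.Equivalent (C := C)) where
  refl P := ModEquiv.refl C P.M
  symm h := ModEquiv.symm h
  trans h h' := ModEquiv.trans h h'

/-- Transporting along `morita_iff_modEquiv` avoids composing bicoact functors by cotensor products.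
-/
lemma morita_equivalence : Equivalence (Morita (C := C) (D := C)) where
  refl K := (morita_iff_modEquiv K K).2 (ModEquiv.refl C K.EM)
  symm h := (morita_iff_modEquiv _ _).2 ((morita_iff_modEquiv _ _).1 h).symm
  trans h h' := (morita_iff_modEquiv _ _).2
    (((morita_iff_modEquiv _ _).1 h).trans ((morita_iff_modEquiv _ _).1 h'))

namespace ReconstructionPair

variable (P : ReconstructionPair.{v, u} C)

lemma preservesFiniteLimits_comonad {L : P.M ⥤ C} (adj : L ⊣ actOn C P.X) :
    PreservesFiniteLimits (OplaxModuleComonad.ofAdjunction (C := C) adj).toFunctor := by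
  have := P.isPair.leftExact
  have := P.isPair.preservesFiniteLimits adj
  exact inferInstanceAs (PreservesFiniteLimits (actOn C P.X ⋙ L))

lemma modEquiv_comonad {L : P.M ⥤ C} (adj : L ⊣ actOn C P.X)
    (h : PreservesFiniteLimits (OplaxModuleComonad.ofAdjunction (C := C) adj).toFunctor) :
    ModEquiv C P.M (LeftExactComonad.ofAdjunction adj h).EM := by
  obtain ⟨_⟩ := P.isPair.abelian
  have := P.isPair.leftExact
  have := P.isPair.preservesFiniteLimits adj
  have := P.isPair.reflectsIsomorphisms adj
  exact modEquiv_ofAdjunction adj h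

/-- The comonad of a pair. -/
noncomputable def comonad : LeftExactComonad C C :=
  have := P.isPair.coclosed
  LeftExactComonad.ofAdjunction (Adjunction.ofIsRightAdjoint (actOn C P.X))
    (P.preservesFiniteLimits_comonad _)

lemma modEquiv_EM_comonad : ModEquiv C P.M P.comonad.EM :=
  P.modEquiv_comonad _ _

/-- The Morita class does not depend on the chosen left adjoint, since every choice has
Eilenberg–Moore category equivalent to `P.M`. -/
lemma morita_comonad {L : P.M ⥤ C} (adj : L ⊣ actOn C P.X)
    (h : PreservesFiniteLimits (OplaxModuleComonad.ofAdjunction (C := C) adj).toFunctor) :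
    Morita P.comonad (LeftExactComonad.ofAdjunction adj h) :=
  (morita_iff_modEquiv _ _).2 (P.modEquiv_EM_comonad.symm.trans (P.modEquiv_comonad adj h))

end ReconstructionPair

/-- The Eilenberg--Moore category of a comonad, with the cofree comodule on the unit. -/
noncomputable def LeftExactComonad.pair (K : LeftExactComonad C C) :
    ReconstructionPair.{v, u} C :=
  ⟨K.EM, K.cofree.obj (𝟙_ C), K.isReconstructionPair⟩

/-- The correspondence between pairs up to equivalence of module categories and comonads up to
Morita equivalence. -/
noncomputable def pairEquivComonad :
    Quotient (Setoid.mk (ReconstructionPair.Equivalent (C := C))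
      ReconstructionPair.equivalent_equivalence) ≃
    Quotient (Setoid.mk (Morita (C := C) (D := C)) morita_equivalence) where
  toFun := Quotient.map' (fun P => P.comonad) fun P Q h => (morita_iff_modEquiv _ _).2
    ((P.modEquiv_EM_comonad.symm.trans h).trans Q.modEquiv_EM_comonad)
  invFun := Quotient.map' (fun K => K.pair) fun K K' h => (morita_iff_modEquiv K K').1 h
  left_inv := by
    rintro ⟨P⟩
    exact Quotient.sound P.modEquiv_EM_comonad.symm
  right_inv := by
    rintro ⟨K⟩
    -- The comonad of `K.pair` need not be compared with `K` directly: reconstruction gives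
    -- equivalent Eilenberg–Moore categories, hence Morita equivalence.
    exact Quotient.sound ((morita_iff_modEquiv _ _).2 K.pair.modEquiv_EM_comonad.symm)

end Correspondence

end ModCat

theorem theorem6p13 {C : Type u} [Category.{v} C] [Abelian C] [MonoidalCategory C]
    [EnoughInjectives C] [ModCat.SeparatelyLeftExact C C] :
    ∃ (hE : Equivalence (ModCat.ReconstructionPair.Equivalent (C := C)))
      (hM : Equivalence (ModCat.Morita (C := C) (D := C)))
      (Φ : Quotient (Setoid.mk (ModCat.ReconstructionPair.Equivalent (C := C)) hE) ≃
        Quotient (Setoid.mk (ModCat.Morita (C := C) (D := C)) hM)),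
      (∀ (P : ModCat.ReconstructionPair.{v, u} C) (L : P.M ⥤ C) (adj : L ⊣ ModCat.actOn C P.X),
        ∃ h : PreservesFiniteLimits
            (ModCat.OplaxModuleComonad.ofAdjunction (C := C) adj).toFunctor,
          Φ (Quotient.mk _ P) =
            Quotient.mk _ ⟨ModCat.OplaxModuleComonad.ofAdjunction (C := C) adj, h⟩) ∧
      (∀ K : ModCat.LeftExactComonad C C,
        ∃ h : ModCat.IsReconstructionPair C (M := K.EM) (K.cofree.obj (𝟙_ C)),
          Φ.symm (Quotient.mk _ K) = Quotient.mk _ ⟨K.EM, K.cofree.obj (𝟙_ C), h⟩) ∧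
      (∀ K K' : ModCat.LeftExactComonad C C,
        ModCat.Morita K K' ↔ ModCat.ModEquiv C K.EM K'.EM) := by
  refine ⟨ModCat.ReconstructionPair.equivalent_equivalence, ModCat.morita_equivalence,
    ModCat.pairEquivComonad, fun P L adj => ⟨P.preservesFiniteLimits_comonad adj, ?_⟩,
    fun K => ⟨K.isReconstructionPair, rfl⟩, ModCat.morita_iff_modEquiv⟩
  exact Quotient.sound (P.morita_comonad adj _)
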